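/- For an odd integer $M\ge 1$ let $N=M^2$, and equip the functions $\mathbb Z/N\mathbb Z\to\mathbb C$ with the norms $\|\psi\|_2^2=\frac1N\sum_{Q}|\psi(Q)|^2$ and $\|\psi\|_\infty=\max_Q|\psi(Q)|$; $\psi$ is normalized if $\|\psi\|_2=1$. Write $n_b=\begin{pmatrix}1&b\\0&1\end{pmatrix}$, $a_t=\begin{pmatrix}t&0\\0&t^{-1}\end{pmatrix}$, $\omega=\begin{pmatrix}0&1\\-1&0\end{pmatrix}$. Quantization. For a prime power $p^{2k}$, $p$ odd, and a unit $r$ of $\mathbb Z/p^{2k}\mathbb Z$, let $U_{p^{2k}}$ be the Weil representation of $SL(2,\mathbb Z/p^{2k}\mathbb Z)$ on the functions on $\mathbb Z/p^{2k}\mathbb Z$, that is, the representation given on generators by $$U(n_b)\psi(x)=e^{2\pi i rbx^2/p^{2k}}\psi(x),\qquad U(a_t)\psi(x)=\psi(tx),\qquad U(\omega)\psi(x)=\frac1{p^{k}}\sum_{y}\psi(y)e^{2\pi i\,2rxy/p^{2k}}$$ (the usual choice is $2r\equiv1$; the statement holds for every unit $r$). For general $N=M^2$, with a unit $r$ of $\mathbb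 Z/N\mathbb Z$, put $U_N(g)=\bigotimes_{p\mid N}U_{p^{2k_p}}(g)$, where $N=\prod_p p^{2k_p}$, using the Chinese remainder theorem and reducing $g$ and $r$ modulo $p^{2k_p}$. Hecke eigenfunctions. Let $A\in SL(2,\mathbb Z)$. The Hecke operators of $A$ are the $U_N(g)$ for $g=xI+yA$ with $x,y\in\mathbb Z/N\mathbb Z$ and $\det g=1$. A Hecke eigenfunction is a nonzero joint eigenfunction of all of them. If $A$ is not upper triangular modulo any prime dividing $N$, then for a unique $D\in\mathbb Z/N\mathbb Z$ one has $A\equiv n_b\,h\,n_{-b}\pmod N$ with some $b$ and some $h=\begin{pmatrix}\alpha&\beta D\\\beta&\alpha\end{pmatrix}$, $\alpha^2-D\beta^2=1$. A prime $p\mid N$ is called split or inert if $p\nmid D$ and $D$ is, respectively is not, a square modulo $p$. Theorem. (1) Let $N=p^{2k}$ with $p>3$ prime and $k\ge1$, assume that $A$ is not upper triangular modulo $p$, and that $p\nmid D$ (that is, $p$ is split or inert). Then every normalized Hecke eigenfunction $\psi$ satisfies $\|\psi\|_\infty\le N^{1/4}$, and the bound is sharp: there is a normalized Hecke eigenfunction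 with $\|\psi\|_\infty=N^{1/4}$. (2) The same two assertions hold for every product $N=M^2=\prod_p p^{2k_p}$ of such prime powers, that is, whenever every prime $p\mid M$ satisfies $p>3$ and $p\nmid D$, and $A$ is not upper triangular modulo $p$. -/

import Mathlib

/-!
Quantized cat maps on `ℤ/Nℤ` for `N = M ^ 2`, `M` odd, and their Hecke eigenfunctions.

The state space is the space of functions `ZMod N → ℂ`, with the inner product
`⟨φ, ψ⟩ = (1 / N) ∑ φ(Q) conj ψ(Q)`. Operators are matrices indexed by `ZMod N`.
-/

namespace CatMap

open Matrix

/-! ### The Weil representation of `SL(2, ℤ/q²ℤ)`, where `q` is a power of an odd prime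

Since the exponent of the prime in `q ^ 2` is even, the unimodular constants in the usual
formulas on the generators are equal to `1`. We write `e(x / N)` for
`ZMod.stdAddChar (x : ZMod N) = exp (2 π i x / N)`. -/

section Local

/-- `n_b = (1 b; 0 1)`. -/
def nMat {R : Type*} [CommRing R] (b : R) : SpecialLinearGroup (Fin 2) R :=
  ⟨!![1, b; 0, 1], by simp [det_fin_two_of]⟩

/-- `a_t = (t 0; 0 t⁻¹)`. -/
def aMat {R : Type*} [CommRing R] (t : Rˣ) : SpecialLinearGroup (Fin 2) R :=
  ⟨!![(t : R), 0; 0, ((t⁻¹ : Rˣ) : R)], by simp [det_fin_two_of]⟩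

/-- `ω = (0 1; -1 0)`. -/
def wMat {R : Type*} [CommRing R] : SpecialLinearGroup (Fin 2) R :=
  ⟨!![0, 1; -1, 0], by simp [det_fin_two_of]⟩

variable (q : ℕ) [NeZero q] (r : (ZMod (q ^ 2))ˣ)

/-- `U(n_b) ψ (x) = e(r b x² / q²) ψ(x)`. -/
noncomputable def opN (b : ZMod (q ^ 2)) : Matrix (ZMod (q ^ 2)) (ZMod (q ^ 2)) ℂ :=
  diagonal fun x => ZMod.stdAddChar ((r : ZMod (q ^ 2)) * b * x ^ 2)

/-- `U(a_t) ψ (x) = ψ(t x)`. -/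
def opA (t : (ZMod (q ^ 2))ˣ) : Matrix (ZMod (q ^ 2)) (ZMod (q ^ 2)) ℂ :=
  of fun x y => if y = (t : ZMod (q ^ 2)) * x then 1 else 0

/-- `U(ω) ψ (x) = (1 / q) ∑ y, ψ(y) e(2 r x y / q²)`; note that `q = √(q²)`. -/
noncomputable def opW : Matrix (ZMod (q ^ 2)) (ZMod (q ^ 2)) ℂ :=
  of fun x y => (1 / (q : ℂ)) * ZMod.stdAddChar (2 * (r : ZMod (q ^ 2)) * x * y)

/-- The operator of a matrix `(a b; c d)` with invertible `c`, through the factorization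
`(a b; c d) = n_{a / c} ω n_{c d} a_{-c}`. -/
noncomputable def bigCell (a d : ZMod (q ^ 2)) (c : (ZMod (q ^ 2))ˣ) :
    Matrix (ZMod (q ^ 2)) (ZMod (q ^ 2)) ℂ :=
  opN q r (a * ((c⁻¹ : (ZMod (q ^ 2))ˣ) : ZMod (q ^ 2))) * opW q r *
    opN q r ((c : ZMod (q ^ 2)) * d) * opA q (-c)

open Classical in
/-- The Weil representation `U_{q²}` of `SL(2, ℤ/q²ℤ)`, for `q` a power of an odd prime and a
unit `r`. If `g = (a b; c d)` and `c` is not a unit then `a` is a unit, and one uses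
`g = ω · (-c -d; a b)`. See `weil_mul`, `weil_nMat`, `weil_aMat`, `weil_wMat`: this is the
homomorphism with the above values on the generators. -/
noncomputable def weil (g : SpecialLinearGroup (Fin 2) (ZMod (q ^ 2))) :
    Matrix (ZMod (q ^ 2)) (ZMod (q ^ 2)) ℂ :=
  if hc : IsUnit (g 1 0) then bigCell q r (g 0 0) (g 1 1) hc.unit
  else if ha : IsUnit (g 0 0) then opW q r * bigCell q r (-g 1 0) (g 0 1) ha.unit
  else 0

/-! #### `weil` is the Weil representation -/

/-- Up to the choice of a scalar, `∑ t, e(2 r x₁ t / q) δ_{x₂ + q t}`. -/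
noncomputable def zeta (x₁ x₂ : ZMod (q ^ 2)) : ZMod (q ^ 2) → ℂ := fun y =>
  if (q : ZMod (q ^ 2)) * (y - x₂) = 0 then
    ZMod.stdAddChar (2 * (r : ZMod (q ^ 2)) * x₁ * (y - x₂)) else 0

/-- `W` maps every `ζ_x` to `e(r (x₁' x₂' - x₁ x₂) / q²) ζ_{x'}`, where `x' = g x`. -/
def Acts (W : Matrix (ZMod (q ^ 2)) (ZMod (q ^ 2)) ℂ)
    (g : SpecialLinearGroup (Fin 2) (ZMod (q ^ 2))) : Prop :=
  ∀ x₁ x₂, W *ᵥ zeta q r x₁ x₂ =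
    ZMod.stdAddChar ((r : ZMod (q ^ 2)) *
      ((g 0 0 * x₁ + g 0 1 * x₂) * (g 1 0 * x₁ + g 1 1 * x₂) - x₁ * x₂)) •
      zeta q r (g 0 0 * x₁ + g 0 1 * x₂) (g 1 0 * x₁ + g 1 1 * x₂)

variable {q r}

theorem exists_mul_of_mul_eq_zero {w : ZMod (q ^ 2)} (h : (q : ZMod (q ^ 2)) * w = 0) :
    ∃ j < q, (q : ZMod (q ^ 2)) * (j : ZMod (q ^ 2)) = w := by
  have hq : 0 < q := Nat.pos_of_ne_zero (NeZero.ne q)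
  obtain ⟨v, hv, rfl⟩ : ∃ v : ℕ, v < q ^ 2 ∧ (v : ZMod (q ^ 2)) = w :=
    ⟨w.val, ZMod.val_lt w, ZMod.natCast_zmod_val w⟩
  rw [← Nat.cast_mul, ZMod.natCast_eq_zero_iff, pow_two] at h
  obtain ⟨j, rfl⟩ := Nat.dvd_of_mul_dvd_mul_left hq h
  refine ⟨j, ?_, by push_cast; ring⟩
  rw [pow_two] at hv
  exact Nat.lt_of_mul_lt_mul_left hv

theorem q_mul_q {q : ℕ} : (q : ZMod (q ^ 2)) * (q : ZMod (q ^ 2)) = 0 := by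
  rw [← Nat.cast_mul, ← pow_two, ZMod.natCast_self]

theorem sum_range_char (u : ZMod (q ^ 2)) :
    ∑ j ∈ Finset.range q, (ZMod.stdAddChar (u * ((q : ZMod (q ^ 2)) * (j : ZMod (q ^ 2)))) : ℂ) =
      if (q : ZMod (q ^ 2)) * u = 0 then (q : ℂ) else 0 := by
  have h1 : ∀ j : ℕ, (ZMod.stdAddChar (u * ((q : ZMod (q ^ 2)) * (j : ZMod (q ^ 2)))) : ℂ) =
      (ZMod.stdAddChar ((q : ZMod (q ^ 2)) * u)) ^ j := by
    intro j
    rw [← AddChar.map_nsmul_eq_pow]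
    congr 1
    rw [nsmul_eq_mul]; ring
  simp_rw [h1]
  split_ifs with h
  · simp [h]
  · have hne : (ZMod.stdAddChar ((q : ZMod (q ^ 2)) * u) : ℂ) ≠ 1 := by
      intro h2
      apply h
      apply ZMod.injective_stdAddChar
      rw [h2, AddChar.map_zero_eq_one]
    rw [geom_sum_eq hne, ← AddChar.map_nsmul_eq_pow, nsmul_eq_mul, ← mul_assoc, q_mul_q]
    simp

theorem sum_range_ite (w : ZMod (q ^ 2)) :
    ∑ j ∈ Finset.range q, (if (q : ZMod (q ^ 2)) * (j : ZMod (q ^ 2)) = w then (1 : ℂ) else 0) =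
      if (q : ZMod (q ^ 2)) * w = 0 then 1 else 0 := by
  split_ifs with h
  · obtain ⟨j, hj, rfl⟩ := exists_mul_of_mul_eq_zero h
    rw [Finset.sum_eq_single_of_mem j (Finset.mem_range.2 hj)]
    · simp
    · intro i hi hij
      rw [if_neg]
      intro h2
      apply hij
      rw [Finset.mem_range] at hi
      rw [← Nat.cast_mul, ← Nat.cast_mul, ZMod.natCast_eq_natCast_iff', pow_two,
        Nat.mod_eq_of_lt (Nat.mul_lt_mul_of_pos_left hi (by lia)),
        Nat.mod_eq_of_lt (Nat.mul_lt_mul_of_pos_left hj (by lia))] at h2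
      exact Nat.eq_of_mul_eq_mul_left (by lia) h2
  · apply Finset.sum_eq_zero
    intro j _
    rw [if_neg]
    rintro rfl
    apply h
    rw [← mul_assoc, q_mul_q, zero_mul]

theorem sum_ideal_char (w : ZMod (q ^ 2)) :
    ∑ u : ZMod (q ^ 2), (if (q : ZMod (q ^ 2)) * u = 0 then
      (ZMod.stdAddChar (w * u) : ℂ) else 0) =
      if (q : ZMod (q ^ 2)) * w = 0 then (q : ℂ) else 0 := by
  have hq : (q : ℂ) ≠ 0 := Nat.cast_ne_zero.2 (NeZero.ne q)
  have h1 : ∀ u : ZMod (q ^ 2), (q : ℂ) * (if (q : ZMod (q ^ 2)) * u = 0 then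
      (ZMod.stdAddChar (w * u) : ℂ) else 0) =
      ∑ j ∈ Finset.range q, ZMod.stdAddChar (u * ((q : ZMod (q ^ 2)) * (j : ZMod (q ^ 2)) - (-w))) := by
    intro u
    have := sum_range_char u
    have h2 : ∀ j : ℕ, (ZMod.stdAddChar (u * ((q : ZMod (q ^ 2)) * (j : ZMod (q ^ 2)) - (-w))) : ℂ) =
        ZMod.stdAddChar (w * u) * ZMod.stdAddChar (u * ((q : ZMod (q ^ 2)) * (j : ZMod (q ^ 2)))) := by
      intro j
      rw [← AddChar.map_add_eq_mul]
      congr 1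
      ring
    simp_rw [h2, ← Finset.mul_sum, this]
    split_ifs <;> ring
  apply mul_left_cancel₀ hq
  rw [Finset.mul_sum]
  simp_rw [h1]
  rw [Finset.sum_comm]
  simp_rw [AddChar.sum_mulShift _ (ZMod.isPrimitive_stdAddChar (q ^ 2)), sub_eq_zero]
  have h3 := sum_range_ite (q := q) (-w)
  have h4 : ∀ j : ℕ, (((if (q : ZMod (q ^ 2)) * (j : ZMod (q ^ 2)) = -w then
      Fintype.card (ZMod (q ^ 2)) else 0 : ℕ)) : ℂ) =
      (q : ℂ) ^ 2 * (if (q : ZMod (q ^ 2)) * (j : ZMod (q ^ 2)) = -w then (1 : ℂ) else 0) := by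
    intro j
    rw [ZMod.card]
    split_ifs <;> simp
  simp_rw [h4]
  rw [← Finset.mul_sum, h3]
  simp only [mul_neg, neg_eq_zero]
  split_ifs <;> ring

theorem mul_entry {R : Type*} [CommRing R] (g h : SpecialLinearGroup (Fin 2) R) (i j : Fin 2) :
    (g * h) i j = g i 0 * h 0 j + g i 1 * h 1 j := by
  change (g.1 * h.1) i j = _
  rw [mul_apply, Fin.sum_univ_two]

theorem acts_mul {W W' : Matrix (ZMod (q ^ 2)) (ZMod (q ^ 2)) ℂ}
    {g g' : SpecialLinearGroup (Fin 2) (ZMod (q ^ 2))} (h : Acts q r W g)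
    (h' : Acts q r W' g') : Acts q r (W * W') (g * g') := by
  intro x₁ x₂
  rw [← mulVec_mulVec, h', mulVec_smul, h, smul_smul, ← AddChar.map_add_eq_mul]
  simp only [mul_entry]
  congr 2
  · ring
  · ring
  · ring

theorem acts_opN (b : ZMod (q ^ 2)) : Acts q r (opN q r b) (nMat b) := by
  intro x₁ x₂
  ext y
  simp only [opN, mulVec_diagonal, zeta, nMat, Pi.smul_apply, smul_eq_mul]
  simp only [of_apply, cons_val', cons_val_zero, cons_val_one,
    cons_val_fin_one, zero_mul, one_mul, zero_add]
  split_ifs with h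
  · rw [← AddChar.map_add_eq_mul, ← AddChar.map_add_eq_mul]
    congr 1
    obtain ⟨j, -, hj⟩ := exists_mul_of_mul_eq_zero h
    have h2 : (y - x₂) ^ 2 = 0 := by
      linear_combination (j : ZMod (q ^ 2)) * h - (y - x₂) * hj
    linear_combination (r : ZMod (q ^ 2)) * b * h2
  · simp

theorem acts_opA (t : (ZMod (q ^ 2))ˣ) : Acts q r (opA q t) (aMat t) := by
  intro x₁ x₂
  ext y
  have ht : (t : ZMod (q ^ 2)) * ((t⁻¹ : (ZMod (q ^ 2))ˣ) : ZMod (q ^ 2)) = 1 := by simp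
  simp only [opA, mulVec, dotProduct, of_apply, zeta, aMat, Pi.smul_apply, smul_eq_mul]
  simp only [cons_val', cons_val_zero, cons_val_one,
    cons_val_fin_one, zero_mul, zero_add, add_zero, ite_mul, one_mul, Finset.sum_ite_eq',
    Finset.mem_univ, if_true]
  have hiff : (q : ZMod (q ^ 2)) * ((t : ZMod (q ^ 2)) * y - x₂) = 0 ↔
      (q : ZMod (q ^ 2)) * (y - ((t⁻¹ : (ZMod (q ^ 2))ˣ) : ZMod (q ^ 2)) * x₂) = 0 := by
    constructor <;> intro h
    · linear_combination ((t⁻¹ : (ZMod (q ^ 2))ˣ) : ZMod (q ^ 2)) * h - (q : ZMod (q ^ 2)) * y * ht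
    · linear_combination (t : ZMod (q ^ 2)) * h + (q : ZMod (q ^ 2)) * x₂ * ht
  simp only [hiff]
  split_ifs with h
  · rw [← AddChar.map_add_eq_mul]
    congr 1
    linear_combination (r : ZMod (q ^ 2)) * x₁ * x₂ * ht
  · simp

theorem acts_opW (h2 : IsUnit (2 : ZMod (q ^ 2))) : Acts q r (opW q r) wMat := by
  intro x₁ x₂
  ext z
  have hq : (q : ℂ) ≠ 0 := Nat.cast_ne_zero.2 (NeZero.ne q)
  simp only [opW, mulVec, dotProduct, of_apply, zeta, wMat, Pi.smul_apply, smul_eq_mul]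
  simp only [cons_val', cons_val_zero, cons_val_one,
    cons_val_fin_one, zero_mul, one_mul, zero_add, add_zero]
  rw [← Equiv.sum_comp (Equiv.addRight x₂)]
  have h3 : ∀ u : ZMod (q ^ 2), 1 / (q : ℂ) *
      ZMod.stdAddChar (2 * (r : ZMod (q ^ 2)) * z * (Equiv.addRight x₂ u)) *
      (if (q : ZMod (q ^ 2)) * (Equiv.addRight x₂ u - x₂) = 0 then
        (ZMod.stdAddChar (2 * (r : ZMod (q ^ 2)) * x₁ * (Equiv.addRight x₂ u - x₂)) : ℂ) else 0)
      = 1 / (q : ℂ) * ZMod.stdAddChar (2 * (r : ZMod (q ^ 2)) * z * x₂) *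
        (if (q : ZMod (q ^ 2)) * u = 0 then
          (ZMod.stdAddChar (2 * (r : ZMod (q ^ 2)) * (z + x₁) * u) : ℂ) else 0) := by
    intro u
    simp only [Equiv.coe_addRight, add_sub_cancel_right]
    split_ifs
    · rw [mul_assoc (1 / (q : ℂ)), mul_assoc (1 / (q : ℂ)), ← AddChar.map_add_eq_mul,
        ← AddChar.map_add_eq_mul]
      congr 2
      ring
    · simp
  simp_rw [h3]
  rw [← Finset.mul_sum, sum_ideal_char]
  have hu : IsUnit (2 * (r : ZMod (q ^ 2))) := h2.mul r.isUnit
  have hiff : (q : ZMod (q ^ 2)) * (2 * (r : ZMod (q ^ 2)) * (z + x₁)) = 0 ↔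
      (q : ZMod (q ^ 2)) * (z - -1 * x₁) = 0 := by
    rw [show (q : ZMod (q ^ 2)) * (2 * (r : ZMod (q ^ 2)) * (z + x₁)) =
      2 * (r : ZMod (q ^ 2)) * ((q : ZMod (q ^ 2)) * (z - -1 * x₁)) by ring, hu.mul_right_eq_zero]
  simp only [hiff]
  split_ifs
  · rw [← AddChar.map_add_eq_mul, mul_right_comm, one_div, inv_mul_cancel₀ hq, one_mul]
    congr 1
    ring
  · simp

/-- An operator is determined by its action on the functions `ζ_x`. -/
theorem Acts.unique (h2 : IsUnit (2 : ZMod (q ^ 2)))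
    {W W' : Matrix (ZMod (q ^ 2)) (ZMod (q ^ 2)) ℂ}
    {g : SpecialLinearGroup (Fin 2) (ZMod (q ^ 2))} (h : Acts q r W g) (h' : Acts q r W' g) :
    W = W' := by
  have hq : (q : ℂ) ≠ 0 := Nat.cast_ne_zero.2 (NeZero.ne q)
  have hu : IsUnit (2 * (r : ZMod (q ^ 2))) := h2.mul r.isUnit
  have key : ∀ y₀ : ZMod (q ^ 2), ∑ j ∈ Finset.range q, zeta q r (j : ZMod (q ^ 2)) y₀ =
      (q : ℂ) • Pi.single y₀ (1 : ℂ) := by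
    intro y₀
    ext y
    simp only [Finset.sum_apply, zeta, Pi.smul_apply, smul_eq_mul]
    by_cases hy : (q : ZMod (q ^ 2)) * (y - y₀) = 0
    · obtain ⟨a, -, ha⟩ := exists_mul_of_mul_eq_zero hy
      have hs := sum_range_char (q := q) (2 * (r : ZMod (q ^ 2)) * (a : ZMod (q ^ 2)))
      simp only [hy, if_true]
      have e1 : ∀ j : ℕ, (2 * (r : ZMod (q ^ 2)) * (j : ZMod (q ^ 2)) * (y - y₀)) =
          2 * (r : ZMod (q ^ 2)) * (a : ZMod (q ^ 2)) * ((q : ZMod (q ^ 2)) * (j : ZMod (q ^ 2))) := by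
        intro j; rw [← ha]; ring
      simp_rw [e1]
      rw [hs, show (q : ZMod (q ^ 2)) * (2 * (r : ZMod (q ^ 2)) * (a : ZMod (q ^ 2))) =
        2 * (r : ZMod (q ^ 2)) * ((q : ZMod (q ^ 2)) * (a : ZMod (q ^ 2))) by ring, ha]
      simp only [hu.mul_right_eq_zero, sub_eq_zero, Pi.single_apply]
      split_ifs <;> simp
    · have hne : y ≠ y₀ := by rintro rfl; simp at hy
      simp [hy, hne]
  have hz : ∀ x₁ x₂, W *ᵥ zeta q r x₁ x₂ = W' *ᵥ zeta q r x₁ x₂ := by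
    intro x₁ x₂; rw [h, h']
  ext x y
  have h3 : W *ᵥ ((q : ℂ) • Pi.single y (1 : ℂ)) = W' *ᵥ ((q : ℂ) • Pi.single y (1 : ℂ)) := by
    rw [← key, mulVec_sum, mulVec_sum]
    exact Finset.sum_congr rfl fun j _ => hz _ _
  have h4 := congrFun h3 x
  simp only [mulVec_smul, mulVec_single_one, Pi.smul_apply, smul_eq_mul] at h4
  exact mul_left_cancel₀ hq h4

theorem acts_bigCell (h2 : IsUnit (2 : ZMod (q ^ 2)))
    (g : SpecialLinearGroup (Fin 2) (ZMod (q ^ 2))) (c : (ZMod (q ^ 2))ˣ)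
    (hc : (c : ZMod (q ^ 2)) = g 1 0) : Acts q r (bigCell q r (g 0 0) (g 1 1) c) g := by
  have h := acts_mul (acts_mul (acts_mul (acts_opN (r := r)
    (g 0 0 * ((c⁻¹ : (ZMod (q ^ 2))ˣ) : ZMod (q ^ 2)))) (acts_opW h2))
    (acts_opN ((c : ZMod (q ^ 2)) * g 1 1))) (acts_opA (-c))
  have hdet := g.det_coe
  rw [det_fin_two] at hdet
  have hci : (c : ZMod (q ^ 2)) * ((c⁻¹ : (ZMod (q ^ 2))ˣ) : ZMod (q ^ 2)) = 1 := by simp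
  have hg : g = nMat (g 0 0 * ((c⁻¹ : (ZMod (q ^ 2))ˣ) : ZMod (q ^ 2))) * wMat *
      nMat ((c : ZMod (q ^ 2)) * g 1 1) * aMat (-c) := by
    rw [← hc] at hdet
    ext i j
    fin_cases i <;> fin_cases j <;> simp only [mul_entry] <;> simp [nMat, aMat, wMat, ← hc]
    · linear_combination -((c⁻¹ : (ZMod (q ^ 2))ˣ) : ZMod (q ^ 2)) * hdet -
        (g 0 1 + ((c⁻¹ : (ZMod (q ^ 2))ˣ) : ZMod (q ^ 2)) * g 0 0 * g 1 1) * hci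
    · linear_combination -g 1 1 * hci
  rw [← hg] at h
  exact h

theorem wMat_inv {R : Type*} [CommRing R] :
    (wMat : SpecialLinearGroup (Fin 2) R)⁻¹ = aMat (-1) * wMat := by
  apply inv_eq_of_mul_eq_one_right
  ext i j
  fin_cases i <;> fin_cases j <;> simp only [mul_entry] <;> simp [wMat, aMat]

theorem acts_weil (h2 : IsUnit (2 : ZMod (q ^ 2)))
    (hloc : ∀ x y : ZMod (q ^ 2), IsUnit (x + y) → IsUnit x ∨ IsUnit y)
    (g : SpecialLinearGroup (Fin 2) (ZMod (q ^ 2))) : Acts q r (weil q r g) g := by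
  unfold weil
  split_ifs with hc ha
  · exact acts_bigCell h2 g hc.unit rfl
  · have hw : g = wMat * (wMat⁻¹ * g) := by group
    have e10 : (wMat⁻¹ * g : SpecialLinearGroup (Fin 2) (ZMod (q ^ 2))) 1 0 = g 0 0 := by
      rw [mul_entry, wMat_inv, mul_entry, mul_entry]; simp [wMat, aMat]
    have e00 : (wMat⁻¹ * g : SpecialLinearGroup (Fin 2) (ZMod (q ^ 2))) 0 0 = -g 1 0 := by
      rw [mul_entry, wMat_inv, mul_entry, mul_entry]; simp [wMat, aMat]
    have e11 : (wMat⁻¹ * g : SpecialLinearGroup (Fin 2) (ZMod (q ^ 2))) 1 1 = g 0 1 := by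
      rw [mul_entry, wMat_inv, mul_entry, mul_entry]; simp [wMat, aMat]
    have h := acts_bigCell (r := r) h2 (wMat⁻¹ * g) ha.unit (by rw [e10]; rfl)
    rw [e00, e11] at h
    have h' := acts_mul (acts_opW (r := r) h2) h
    rwa [← hw] at h'
  · exfalso
    have hdet := g.det_coe
    rw [det_fin_two, sub_eq_add_neg] at hdet
    rcases hloc _ _ (hdet ▸ isUnit_one) with h | h
    · exact ha (isUnit_of_mul_isUnit_left h)
    · exact hc (isUnit_of_mul_isUnit_right (IsUnit.neg_iff _ |>.1 h))

theorem isUnit_two {p k : ℕ} [Fact p.Prime] (hp : p ≠ 2) :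
    IsUnit (2 : ZMod ((p ^ k) ^ 2)) := by
  have h : IsUnit ((2 : ℕ) : ZMod ((p ^ k) ^ 2)) := by
    rw [ZMod.isUnit_iff_coprime, ← pow_mul]
    exact Nat.Coprime.pow_right _
      ((Nat.coprime_primes Nat.prime_two Fact.out).2 (Ne.symm hp))
  exact_mod_cast h

theorem isUnit_or_isUnit {p k : ℕ} [Fact p.Prime] (x y : ZMod ((p ^ k) ^ 2))
    (h : IsUnit (x + y)) : IsUnit x ∨ IsUnit y := by
  obtain ⟨x, rfl⟩ := ZMod.natCast_zmod_surjective x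
  obtain ⟨y, rfl⟩ := ZMod.natCast_zmod_surjective y
  rcases Nat.eq_zero_or_pos k with rfl | hk
  · left
    rw [ZMod.isUnit_iff_coprime]; simp
  rw [← Nat.cast_add] at h
  have hp : p.Prime := Fact.out
  have aux : ∀ n : ℕ, IsUnit (n : ZMod ((p ^ k) ^ 2)) ↔ ¬ p ∣ n := by
    intro n
    rw [ZMod.isUnit_iff_coprime, ← pow_mul, Nat.coprime_pow_right_iff (by lia), Nat.coprime_comm,
      hp.coprime_iff_not_dvd]
  rw [aux] at h ⊢
  rw [aux]
  by_contra! hh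
  exact h (dvd_add hh.1 hh.2)

theorem weil_mul {p k : ℕ} [Fact p.Prime] (hp : p ≠ 2) (s : (ZMod ((p ^ k) ^ 2))ˣ)
    (g h : SpecialLinearGroup (Fin 2) (ZMod ((p ^ k) ^ 2))) :
    weil (p ^ k) s (g * h) = weil (p ^ k) s g * weil (p ^ k) s h :=
  (acts_weil (isUnit_two hp) isUnit_or_isUnit _).unique (isUnit_two hp)
    (acts_mul (acts_weil (isUnit_two hp) isUnit_or_isUnit _)
      (acts_weil (isUnit_two hp) isUnit_or_isUnit _))

theorem weil_nMat {p k : ℕ} [Fact p.Prime] (hp : p ≠ 2) (s : (ZMod ((p ^ k) ^ 2))ˣ)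
    (b : ZMod ((p ^ k) ^ 2)) : weil (p ^ k) s (nMat b) = opN (p ^ k) s b :=
  (acts_weil (isUnit_two hp) isUnit_or_isUnit _).unique (isUnit_two hp) (acts_opN b)

theorem weil_aMat {p k : ℕ} [Fact p.Prime] (hp : p ≠ 2) (s : (ZMod ((p ^ k) ^ 2))ˣ)
    (t : (ZMod ((p ^ k) ^ 2))ˣ) : weil (p ^ k) s (aMat t) = opA (p ^ k) t :=
  (acts_weil (isUnit_two hp) isUnit_or_isUnit _).unique (isUnit_two hp) (acts_opA t)

theorem weil_wMat {p k : ℕ} [Fact p.Prime] (hp : p ≠ 2) (s : (ZMod ((p ^ k) ^ 2))ˣ) :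
    weil (p ^ k) s wMat = opW (p ^ k) s :=
  (acts_weil (isUnit_two hp) isUnit_or_isUnit _).unique (isUnit_two hp)
    (acts_opW (isUnit_two hp))

end Local

/-! ### The quantization for `N = M ^ 2` with `M` odd, by tensor products -/

instance instNeZeroOrdProj (M p : ℕ) : NeZero (p ^ M.factorization p) :=
  ⟨(Nat.ordProj_pos M p).ne'⟩

/-- Reduction from `ℤ/N` to `ℤ/p^α`, where `N = M ^ 2` and `p ^ α` is the exact power of `p`
dividing `N`. -/
def red (M p : ℕ) : ZMod (M ^ 2) →+* ZMod ((p ^ M.factorization p) ^ 2) :=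
  ZMod.castHom (pow_dvd_pow_of_dvd (Nat.ordProj_dvd M p) 2) _

/-- `U_N(g) = ⊗_{p ∣ N} U_{p^α}(g mod p^α)`, transported to functions on `ℤ/N` by the Chinese
remainder theorem: a pure tensor `⊗ f_p` is the function `x ↦ ∏ f_p(x mod p^α)`, so the
matrix of a tensor product of operators is the product of their matrices. -/
noncomputable def weilTensor (M : ℕ) (r : (ZMod (M ^ 2))ˣ)
    (g : SpecialLinearGroup (Fin 2) (ZMod (M ^ 2))) :
    Matrix (ZMod (M ^ 2)) (ZMod (M ^ 2)) ℂ :=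
  of fun x y => ∏ p ∈ M.primeFactors,
    weil (p ^ M.factorization p) (Units.map (red M p : ZMod (M ^ 2) →* _) r)
      (SpecialLinearGroup.map (red M p) g) (red M p x) (red M p y)

/-! ### Hecke eigenfunctions -/

/-- The image of an integral matrix in `SL(2, ℤ/Nℤ)`. -/
def modN (N : ℕ) (A : SpecialLinearGroup (Fin 2) ℤ) : SpecialLinearGroup (Fin 2) (ZMod N) :=
  SpecialLinearGroup.map (Int.castRingHom (ZMod N)) A

/-- The elements `g = x I + y A` of determinant `1` over `ℤ/Nℤ`; the Hecke operators of `A` are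
the operators `U_N(g)` for these `g`. -/
def heckeElements (N : ℕ) (A : SpecialLinearGroup (Fin 2) ℤ) :
    Set (SpecialLinearGroup (Fin 2) (ZMod N)) :=
  {g | ∃ x y : ZMod N, (g : Matrix (Fin 2) (Fin 2) (ZMod N)) =
    x • (1 : Matrix (Fin 2) (Fin 2) (ZMod N)) +
      y • (modN N A : Matrix (Fin 2) (Fin 2) (ZMod N))}

/-- `H_D`, the matrices `(a bD; b a)` with `a² - D b² = 1`. -/
def torus {N : ℕ} (D : ZMod N) : Set (SpecialLinearGroup (Fin 2) (ZMod N)) :=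
  {h | ∃ a b : ZMod N, (h : Matrix (Fin 2) (Fin 2) (ZMod N)) = !![a, b * D; b, a]}

/-- `A ≡ n_b h n_{-b}` modulo `N` for some `b` and some `h ∈ H_D`. If `A` is not upper
triangular modulo any prime divisor of the odd number `N`, there is exactly one such `D`. -/
def HasParameter (N : ℕ) (A : SpecialLinearGroup (Fin 2) ℤ) (D : ZMod N) : Prop :=
  ∃ b : ZMod N, ∃ h ∈ torus D, modN N A = nMat b * h * nMat (-b)

/-- `ψ` is a joint eigenfunction of the operators `U g`, for `g` in the Hecke group of `A`. -/
def IsHeckeEigenfunction {N : ℕ} [NeZero N]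
    (U : SpecialLinearGroup (Fin 2) (ZMod N) → Matrix (ZMod N) (ZMod N) ℂ)
    (A : SpecialLinearGroup (Fin 2) ℤ) (ψ : ZMod N → ℂ) : Prop :=
  ψ ≠ 0 ∧ ∀ g ∈ heckeElements N A, ∃ c : ℂ, U g *ᵥ ψ = c • ψ

/-- `‖ψ‖₂ = 1` for the norm of `⟨φ, ψ⟩ = (1 / N) ∑ φ(Q) conj ψ(Q)`. -/
def IsNormalized {N : ℕ} [NeZero N] (ψ : ZMod N → ℂ) : Prop :=
  (1 / (N : ℝ)) * ∑ Q : ZMod N, ‖ψ Q‖ ^ 2 = 1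

/-- `‖ψ‖_∞`. -/
noncomputable def supNorm {N : ℕ} (ψ : ZMod N → ℂ) : ℝ := ⨆ Q : ZMod N, ‖ψ Q‖

end CatMap

/-! Take first a prime power, with `q = p ^ k`. The Weil representation permutes the functions `ζ_x`
up to phases. Let `c x₁ x₂` be `⟨ψ, ζ_x⟩` times a phase that absorbs this cocycle (`zetaCoeff`).
Orthogonality of characters gives the inversion formula `q ψ(y) = ∑_{x < q} e(r x y / q²) c x y` and
Parseval's identity `∑ |c|² = q ∑ |ψ|²` over a `q × q` square. After conjugation by `n_b` the Hecke
group becomes `H_D`, and the upper bound becomes `|∑_x e(r x y / q²) c x y|² ≤ ∑ |c|²`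
(`IsThetaCoeff.norm_sq_sum_le`), for functions `c` on the plane that are quasi-periodic under `q ℤ²`
and equivariant under `H_D` up to unimodular scalars.

Two facts control `c`. Its support lies in one level set of `x₁² - D x₂²` modulo `q`
(`dvd_sub_of_ne_zero`), so on the line `x₂ = y` only the solutions of `x² ≡ x₀²` matter. And `|c|`
is constant on torus orbits, which for a primitive point have at least `(p - 1) p^(k-1)` elements
modulo `q` because `p ∤ D` (`mul_norm_sq_le`). If `T` is the number of solutions, Cauchy–Schwarz
finishes as soon as `T² ≤ (p - 1) p^(k-1)` (`card_sqrt_sq_le`).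

Counting fails only when `k` is even and `x₀² ≡ 0`: there `T² = p^k`, too large by the factor `p /
(p - 1)`. On that line the phases behave like a cubic polynomial, and one van der Corput step with
quadratic Gauss sums saves enough when `p > 3` (`norm_sq_sum_vertical_le`, `add_mul_sqrt_le`). When
`p` divides both `x₀` and `y`, the function `c (p x)` has the same structure with `k` lowered by
one, and induction applies.

For composite `M`, Hecke elements that are trivial away from `p` act in a single CRT coordinate, so
every slice of `ψ` satisfies the estimate at `p`, and the estimates multiply
(`prod_mul_le_sum_of_update`). Sharpness: `ζ_0`, a multiple of the indicator function of the
multiples of `M`, is fixed by the whole representation. -/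

namespace CatMap

open Matrix

/-! ### Exponentials -/

/-- `exp (2 π i n / N)`. -/
noncomputable def unitExp (N : ℕ) (n : ℤ) : ℂ :=
  Complex.exp (2 * Real.pi * Complex.I * n / N)

theorem unitExp_add (N : ℕ) (m n : ℤ) : unitExp N (m + n) = unitExp N m * unitExp N n := by
  rw [unitExp, unitExp, unitExp, ← Complex.exp_add]
  congr 1
  push_cast
  ring

theorem norm_unitExp (N : ℕ) (n : ℤ) : ‖unitExp N n‖ = 1 := by
  have : (2 * Real.pi * Complex.I * n / N : ℂ) = ((2 * Real.pi * n / N : ℝ) : ℂ) * Complex.I := by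
    push_cast; ring
  rw [unitExp, this, Complex.norm_exp_ofReal_mul_I]

theorem unitExp_ne_zero (N : ℕ) (n : ℤ) : unitExp N n ≠ 0 := Complex.exp_ne_zero _

theorem unitExp_eq_one_iff {N : ℕ} (hN : N ≠ 0) (n : ℤ) : unitExp N n = 1 ↔ (N : ℤ) ∣ n := by
  have hN' : (N : ℂ) ≠ 0 := Nat.cast_ne_zero.2 hN
  have hpi : (2 * Real.pi * Complex.I : ℂ) ≠ 0 := Complex.two_pi_I_ne_zero
  rw [unitExp, Complex.exp_eq_one_iff]
  constructor
  · rintro ⟨m, hm⟩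
    refine ⟨m, ?_⟩
    have : (n : ℂ) = N * m := by
      field_simp at hm
      exact hm
    exact_mod_cast this
  · rintro ⟨m, rfl⟩
    refine ⟨m, ?_⟩
    push_cast
    field_simp

theorem unitExp_eq_iff {N : ℕ} (hN : N ≠ 0) (m n : ℤ) :
    unitExp N m = unitExp N n ↔ (N : ℤ) ∣ m - n := by
  rw [← unitExp_eq_one_iff hN]
  have h := unitExp_add N (m - n) n
  rw [sub_add_cancel] at h
  rw [h]
  constructor
  · intro h'
    exact mul_right_cancel₀ (unitExp_ne_zero N n) (h'.trans (one_mul _).symm)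
  · intro h'
    rw [h', one_mul]

theorem unitExp_mul_mul {d : ℕ} (hd : d ≠ 0) (N : ℕ) (n : ℤ) :
    unitExp (d * N) (d * n) = unitExp N n := by
  have hd' : (d : ℂ) ≠ 0 := Nat.cast_ne_zero.2 hd
  rw [unitExp, unitExp]
  congr 1
  push_cast
  rw [show (2 * Real.pi * Complex.I * (d * n) / (d * N) : ℂ) =
    (d * (2 * Real.pi * Complex.I * n)) / (d * N) by ring, mul_div_mul_left _ _ hd']

theorem stdAddChar_intCast {N : ℕ} [NeZero N] (n : ℤ) :
    (ZMod.stdAddChar (n : ZMod N) : ℂ) = unitExp N n := by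
  rw [ZMod.stdAddChar_coe, unitExp]

/-! ### Theta coefficients -/

/-- The properties of the coefficients of an eigenfunction of the torus `H_D` with respect to the
system `ζ_x`, as a function of integral `x`, after a change of phase. The elements of `H_D` are
written as `(u + v √D) / (u - v √D)`, and `w` is an inverse of `u² - D v²`. -/
structure IsThetaCoeff (p k : ℕ) (D r : ℤ) (c : ℤ → ℤ → ℂ) : Prop where
  translate : ∀ x₁ x₂ a b : ℤ, c (x₁ + (p : ℤ) ^ k * a) (x₂ + (p : ℤ) ^ k * b) =
    unitExp ((p ^ k) ^ 2) (r * (p : ℤ) ^ k * (b * x₁ - a * x₂)) * c x₁ x₂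
  rotate : ∀ u v : ℤ, ¬ (p : ℤ) ∣ u ^ 2 - D * v ^ 2 → ∃ w : ℤ, ∃ l : ℂ,
    ((p : ℤ) ^ k) ^ 2 ∣ w * (u ^ 2 - D * v ^ 2) - 1 ∧ ‖l‖ = 1 ∧
    ∀ x₁ x₂ : ℤ, c (w * ((u ^ 2 + D * v ^ 2) * x₁ + 2 * u * v * D * x₂))
      (w * (2 * u * v * x₁ + (u ^ 2 + D * v ^ 2) * x₂)) = l * c x₁ x₂

namespace IsThetaCoeff

variable {p k : ℕ} {D r : ℤ} {c : ℤ → ℤ → ℂ}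

theorem norm_translate (h : IsThetaCoeff p k D r c) (x₁ x₂ a b : ℤ) :
    ‖c (x₁ + (p : ℤ) ^ k * a) (x₂ + (p : ℤ) ^ k * b)‖ = ‖c x₁ x₂‖ := by
  rw [h.translate, norm_mul, norm_unitExp, one_mul]

theorem norm_congr (h : IsThetaCoeff p k D r c) {x₁ x₂ y₁ y₂ : ℤ}
    (h₁ : (p : ℤ) ^ k ∣ x₁ - y₁) (h₂ : (p : ℤ) ^ k ∣ x₂ - y₂) : ‖c x₁ x₂‖ = ‖c y₁ y₂‖ := by
  obtain ⟨a, ha⟩ := h₁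
  obtain ⟨b, hb⟩ := h₂
  rw [← h.norm_translate y₁ y₂ a b, ← ha, ← hb]
  simp

/-- Scaling by `p` turns a translation by `p ^ k` into one by `p ^ (k + 1)`. One factor `p` from
this step and one from the scaled point cancel `p²` in the modulus of the phase. Rotations are
linear and commute with the scaling. -/
theorem descend (hp : p ≠ 0) (h : IsThetaCoeff p (k + 1) D r c) :
    IsThetaCoeff p k D r (fun x₁ x₂ => c (p * x₁) (p * x₂)) where
  translate x₁ x₂ a b := by
    have := h.translate (p * x₁) (p * x₂) a b
    have e1 : (p : ℤ) * (x₁ + (p : ℤ) ^ k * a) = p * x₁ + (p : ℤ) ^ (k + 1) * a := by ring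
    have e2 : (p : ℤ) * (x₂ + (p : ℤ) ^ k * b) = p * x₂ + (p : ℤ) ^ (k + 1) * b := by ring
    change c (p * (x₁ + (p : ℤ) ^ k * a)) (p * (x₂ + (p : ℤ) ^ k * b)) = _
    rw [e1, e2, this]
    congr 1
    have := unitExp_mul_mul (pow_ne_zero 2 hp) ((p ^ k) ^ 2) (r * (p : ℤ) ^ k * (b * x₁ - a * x₂))
    rw [← this]
    congr 1
    · ring
    · push_cast; ring
  rotate u v huv := by
    obtain ⟨w, l, hw, hl, hc⟩ := h.rotate u v huv
    refine ⟨w, l, dvd_trans ⟨(p : ℤ) ^ 2, by ring⟩ hw, hl, fun x₁ x₂ => ?_⟩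
    rw [← hc]
    congr 1 <;> ring

/-- The support lies in a level set of the quadratic form modulo `p ^ k`. -/
theorem dvd_sub_of_ne_zero [hp : Fact p.Prime] (hp2 : p ≠ 2) (hr : ¬ (p : ℤ) ∣ r) (hk : k ≠ 0)
    (h : IsThetaCoeff p k D r c) {x₁ x₂ y₁ y₂ : ℤ} (hx : c x₁ x₂ ≠ 0) (hy : c y₁ y₂ ≠ 0) :
    (p : ℤ) ^ k ∣ (x₁ ^ 2 - D * x₂ ^ 2) - (y₁ ^ 2 - D * y₂ ^ 2) := by
  have hpp : Prime (p : ℤ) := Nat.prime_iff_prime_int.1 hp.out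
  set q : ℤ := (p : ℤ) ^ k with hq
  have hq0 : q ≠ 0 := pow_ne_zero _ hpp.ne_zero
  have hpq : (p : ℤ) ∣ q := dvd_pow_self _ hk
  -- The rotation `(1 + q√D) / (1 - q√D)` is trivial modulo `q`: it moves `x` by `q (2 D x₂, 2 x₁)`
  -- modulo `q²`. Its eigenvalue `l` must therefore equal the translation phase at every point of
  -- the support, and this phase reads off the quadratic form modulo `q`.
  obtain ⟨w, l, ⟨z, hz⟩, -, hc⟩ := h.rotate 1 q (by
    intro h1
    have : (p : ℤ) ∣ 1 := by
      have := dvd_add h1 (dvd_mul_of_dvd_right (dvd_pow hpq two_ne_zero) D)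
      simpa using this
    exact hpp.not_isUnit (isUnit_of_dvd_one this))
  have key : ∀ x₁ x₂ : ℤ, c x₁ x₂ ≠ 0 →
      l = unitExp ((p ^ k) ^ 2) (2 * r * q * (x₁ ^ 2 - D * x₂ ^ 2)) := by
    intro x₁ x₂ hx
    have hw : w = 1 + q ^ 2 * (z + w * D) := by linear_combination hz
    have h1 := h.translate x₁ x₂ (2 * D * x₂ + q * ((z + 2 * w * D) * x₁ + 2 * q * (z + w * D) * D * x₂))
      (2 * x₁ + q * ((z + 2 * w * D) * x₂ + 2 * q * (z + w * D) * x₁))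
    have h2 := hc x₁ x₂
    rw [← hq] at h1
    have e1 : w * ((1 ^ 2 + D * q ^ 2) * x₁ + 2 * 1 * q * D * x₂) = x₁ + q * (2 * D * x₂ + q * ((z + 2 * w * D) * x₁ + 2 * q * (z + w * D) * D * x₂)) := by
      linear_combination (x₁ + 2 * q * D * x₂) * hw
    have e2 : w * (2 * 1 * q * x₁ + (1 ^ 2 + D * q ^ 2) * x₂) = x₂ + q * (2 * x₁ + q * ((z + 2 * w * D) * x₂ + 2 * q * (z + w * D) * x₁)) := by
      linear_combination (x₂ + 2 * q * x₁) * hw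
    rw [e1, e2, h1] at h2
    rw [← mul_right_cancel₀ hx h2, unitExp_eq_iff (pow_ne_zero _ (pow_ne_zero _ hp.out.ne_zero))]
    push_cast
    rw [← hq]
    refine ⟨r * (((z + 2 * w * D) * x₂ + 2 * q * (z + w * D) * x₁) * x₁ - ((z + 2 * w * D) * x₁ + 2 * q * (z + w * D) * D * x₂) * x₂), by ring⟩
  have h3 := (key _ _ hx).symm.trans (key _ _ hy)
  rw [unitExp_eq_iff (pow_ne_zero _ (pow_ne_zero _ hp.out.ne_zero))] at h3
  push_cast at h3
  rw [← hq, ← mul_sub, pow_two, show 2 * r * q * (x₁ ^ 2 - D * x₂ ^ 2 - (y₁ ^ 2 - D * y₂ ^ 2)) =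
    q * (2 * r * (x₁ ^ 2 - D * x₂ ^ 2 - (y₁ ^ 2 - D * y₂ ^ 2))) by ring,
    mul_dvd_mul_iff_left hq0, hq] at h3
  have hcop : IsCoprime ((p : ℤ) ^ k) (2 * r) := by
    apply IsCoprime.pow_left
    rw [Prime.coprime_iff_not_dvd hpp]
    intro h4
    rcases hpp.dvd_or_dvd h4 with h5 | h5
    · have : p ∣ 2 := by exact_mod_cast h5
      exact hp2 ((Nat.prime_dvd_prime_iff_eq hp.out Nat.prime_two).1 this)
    · exact hr h5
  exact hcop.dvd_of_dvd_mul_left h3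

end IsThetaCoeff

/-! ### Counting residues and square roots modulo prime powers -/

theorem sum_range_eq_sum_zmod {E : Type*} [AddCommMonoid E] (n : ℕ) [NeZero n] (f : ℕ → E) :
    ∑ i ∈ Finset.range n, f i = ∑ z : ZMod n, f z.val := by
  symm
  refine Finset.sum_bij (fun z _ => z.val) (fun z _ => Finset.mem_range.2 (ZMod.val_lt z))
    (fun a _ b _ hab => ZMod.val_injective n hab) (fun i hi => ?_) (fun z _ => rfl)
  exact ⟨i, Finset.mem_univ _, ZMod.val_cast_of_lt (Finset.mem_range.1 hi)⟩

theorem card_filter_dvd_sub (d m : ℕ) (hd : d ≠ 0) (a : ℤ) :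
    ((Finset.range (d * m)).filter fun t : ℕ => (d : ℤ) ∣ (t : ℤ) - a).card = m := by
  have hd' : (0 : ℤ) < d := by positivity
  obtain ⟨v, hv⟩ : ∃ v : ℕ, (v : ℤ) = a % d :=
    ⟨(a % d).toNat, Int.toNat_of_nonneg (Int.emod_nonneg _ hd'.ne')⟩
  have : ∀ t : ℕ, ((d : ℤ) ∣ (t : ℤ) - a) ↔ t ≡ v [MOD d] := by
    intro t
    rw [← Int.natCast_modEq_iff, hv, Int.modEq_comm, Int.modEq_iff_dvd]
    have h : (d : ℤ) ∣ a - a % d := Int.dvd_self_sub_emod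
    constructor <;> intro h'
    · have := dvd_add h' h; rwa [sub_add_sub_cancel] at this
    · have := dvd_sub h' h; rwa [sub_sub_sub_cancel_right] at this
  simp_rw [this]
  rw [← Nat.count_eq_card_filter_range, Nat.count_modEq_card _ (Nat.pos_of_ne_zero hd)]
  simp [hd]

theorem card_filter_pow_dvd_sub (p : ℕ) (hp : p ≠ 0) (j m : ℕ) (a : ℤ) :
    ((Finset.range (p ^ (j + m))).filter fun t : ℕ => (p : ℤ) ^ j ∣ (t : ℤ) - a).card = p ^ m := by
  have := card_filter_dvd_sub (p ^ j) (p ^ m) (pow_ne_zero _ hp) a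
  rw [← pow_add] at this
  exact_mod_cast this

theorem pow_sub_dvd_of_dvd_mul {p a b : ℤ} (hp : Prime p) {k i : ℕ} (h : p ^ k ∣ a * b)
    (hb : ¬ p ^ (i + 1) ∣ b) : p ^ (k - i) ∣ a := by
  have hb0 : b ≠ 0 := by rintro rfl; exact hb (dvd_zero _)
  obtain ⟨s, hs, hps⟩ := (FiniteMultiplicity.of_prime_left hp hb0).exists_eq_pow_mul_and_not_dvd
  set j := multiplicity p b
  have hji : j ≤ i := by
    by_contra! hlt
    exact hb (dvd_trans (pow_dvd_pow p hlt) ⟨s, hs⟩)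
  rw [hs, ← mul_assoc] at h
  have h1 := hp.pow_dvd_of_dvd_mul_right _ hps h
  rcases le_total k j with hkj | hkj
  · rw [Nat.sub_eq_zero_of_le (hkj.trans hji), pow_zero]; exact one_dvd _
  · have h2 : p ^ (k - j) * p ^ j ∣ a * p ^ j := by rwa [← pow_add, Nat.sub_add_cancel hkj]
    exact (pow_dvd_pow p (by lia)).trans
      ((mul_dvd_mul_iff_right (pow_ne_zero _ hp.ne_zero)).1 h2)

theorem pow_dvd_of_pow_dvd_sq {p a : ℤ} (hp : Prime p) {k m : ℕ} (hm : 2 * m ≤ k + 1)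
    (h : p ^ k ∣ a ^ 2) : p ^ m ∣ a := by
  by_contra hn
  obtain rfl | ⟨i, rfl⟩ : m = 0 ∨ ∃ i, m = i + 1 := by
    rcases m with _ | i
    · exact Or.inl rfl
    · exact Or.inr ⟨i, rfl⟩
  · simp at hn
  · rw [pow_two] at h
    exact hn ((pow_dvd_pow p (by lia)).trans (pow_sub_dvd_of_dvd_mul hp h hn))

theorem not_dvd_two {p : ℕ} [hp : Fact p.Prime] (hp2 : p ≠ 2) : ¬ (p : ℤ) ∣ 2 := by
  intro h
  have : p ∣ 2 := by exact_mod_cast h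
  exact hp2 ((Nat.prime_dvd_prime_iff_eq hp.out Nat.prime_two).1 this)

/-- The number of square roots of a square modulo `p ^ (k + 1)`. -/
theorem card_sqrt_sq_le {p k : ℕ} [hp : Fact p.Prime] (hp3 : 3 < p) (x₀ : ℤ)
    (h : (p : ℤ) ^ (k + 1) ∣ x₀ ^ 2 → Even k) :
    ((Finset.range (p ^ (k + 1))).filter fun x : ℕ =>
      (p : ℤ) ^ (k + 1) ∣ (x : ℤ) ^ 2 - x₀ ^ 2).card ^ 2 ≤ (p - 1) * p ^ k := by
  have hpp : Prime (p : ℤ) := Nat.prime_iff_prime_int.1 hp.out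
  have hp0 : p ≠ 0 := hp.out.ne_zero
  by_cases h0 : (p : ℤ) ^ (k + 1) ∣ x₀ ^ 2
  · obtain ⟨m, rfl⟩ := h h0
    -- The exponent is odd, so divisibility of `x²` rounds up to `p ^ (m + 1) ∣ x`, and only `p ^ m`
    -- residues remain.
    have hsub : ((Finset.range (p ^ (m + m + 1))).filter fun x : ℕ =>
        (p : ℤ) ^ (m + m + 1) ∣ (x : ℤ) ^ 2 - x₀ ^ 2) ⊆
        (Finset.range (p ^ ((m + 1) + m))).filter fun x : ℕ => (p : ℤ) ^ (m + 1) ∣ (x : ℤ) - 0 := by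
      intro x hx
      rw [Finset.mem_filter] at hx ⊢
      refine ⟨by rw [show m + 1 + m = m + m + 1 by ring]; exact hx.1, ?_⟩
      rw [sub_zero]
      have := dvd_add hx.2 h0
      rw [sub_add_cancel] at this
      exact pow_dvd_of_pow_dvd_sq hpp (by lia) this
    have hc := Finset.card_le_card hsub
    rw [card_filter_pow_dvd_sub p hp0] at hc
    calc _ ≤ (p ^ m) ^ 2 := Nat.pow_le_pow_left hc 2
      _ = 1 * p ^ (m + m) := by ring
      _ ≤ _ := Nat.mul_le_mul_right _ (by lia)
  · have hx0 : x₀ ≠ 0 := by rintro rfl; simp at h0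
    obtain ⟨u, hu, hpu⟩ := (FiniteMultiplicity.of_prime_left hpp hx0).exists_eq_pow_mul_and_not_dvd
    set i := multiplicity (p : ℤ) x₀
    have hik : 2 * i ≤ k := by
      by_contra! hlt
      refine h0 (dvd_trans (pow_dvd_pow _ (show k + 1 ≤ 2 * i by lia)) ⟨u ^ 2, ?_⟩)
      rw [hu]; ring
    have hd : k + 1 = (k + 1 - i) + i := by lia
    have hp4 : p ≠ 4 := by
      rintro rfl
      exact absurd hp.out (by norm_num)
    -- The numbers `x ± x₀` differ by `2 x₀`, so `p ^ (i + 1)` cannot divide both, and the other one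
    -- carries at least `p ^ (k + 1 - i)`. This leaves at most `2 p ^ i` residues; the final
    -- comparison uses `4 ≤ p - 1`, hence `p > 3`.
    have hsub : ((Finset.range (p ^ (k + 1))).filter fun x : ℕ =>
        (p : ℤ) ^ (k + 1) ∣ (x : ℤ) ^ 2 - x₀ ^ 2) ⊆
        ((Finset.range (p ^ ((k + 1 - i) + i))).filter fun x : ℕ =>
          (p : ℤ) ^ (k + 1 - i) ∣ (x : ℤ) - x₀) ∪
        ((Finset.range (p ^ ((k + 1 - i) + i))).filter fun x : ℕ =>
          (p : ℤ) ^ (k + 1 - i) ∣ (x : ℤ) - -x₀) := by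
      intro x hx
      rw [Finset.mem_union, Finset.mem_filter, Finset.mem_filter, ← hd]
      rw [Finset.mem_filter] at hx
      rw [← and_or_left, sub_neg_eq_add]
      refine ⟨hx.1, ?_⟩
      have hx2 := hx.2
      rw [sq_sub_sq] at hx2
      by_cases h1 : (p : ℤ) ^ (i + 1) ∣ x + x₀
      · right
        rw [mul_comm] at hx2
        apply pow_sub_dvd_of_dvd_mul hpp (by rwa [mul_comm] at hx2 ⊢)
        intro h2
        have h3 := dvd_sub h1 h2
        rw [show (x : ℤ) + x₀ - (x - x₀) = (p : ℤ) ^ i * (2 * u) by rw [hu]; ring, pow_succ,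
          mul_dvd_mul_iff_left (pow_ne_zero _ hpp.ne_zero)] at h3
        rcases hpp.dvd_or_dvd h3 with h4 | h4
        · exact not_dvd_two (by lia) h4
        · exact hpu h4
      · left
        rw [mul_comm] at hx2
        exact pow_sub_dvd_of_dvd_mul hpp hx2 h1
    have hc := (Finset.card_le_card hsub).trans (Finset.card_union_le _ _)
    rw [card_filter_pow_dvd_sub p hp0, card_filter_pow_dvd_sub p hp0] at hc
    calc _ ≤ (p ^ i + p ^ i) ^ 2 := Nat.pow_le_pow_left hc 2
      _ = 4 * p ^ (2 * i) := by ring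
      _ ≤ (p - 1) * p ^ k := Nat.mul_le_mul (by lia) (Nat.pow_le_pow_right (by lia) hik)

/-! ### Orbits of the torus -/

namespace IsThetaCoeff

variable {p k : ℕ} {D r : ℤ} {c : ℤ → ℤ → ℂ}

/-- If `x` is primitive, then elements of the torus that move `x` to the same point modulo `p ^ k`
are equal modulo `p ^ k`. -/
theorem dvd_cross_of_dvd_sub [hp : Fact p.Prime] (hp2 : p ≠ 2) (hD : ¬ (p : ℤ) ∣ D) {x₁ x₂ : ℤ}
    (hx : ¬ ((p : ℤ) ∣ x₁ ∧ (p : ℤ) ∣ x₂)) {u v w u' v' w' : ℤ}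
    (hw : (p : ℤ) ^ k ∣ w * (u ^ 2 - D * v ^ 2) - 1)
    (hw' : (p : ℤ) ^ k ∣ w' * (u' ^ 2 - D * v' ^ 2) - 1)
    (h₁ : (p : ℤ) ^ k ∣ w * ((u ^ 2 + D * v ^ 2) * x₁ + 2 * u * v * D * x₂) -
      w' * ((u' ^ 2 + D * v' ^ 2) * x₁ + 2 * u' * v' * D * x₂))
    (h₂ : (p : ℤ) ^ k ∣ w * (2 * u * v * x₁ + (u ^ 2 + D * v ^ 2) * x₂) -
      w' * (2 * u' * v' * x₁ + (u' ^ 2 + D * v' ^ 2) * x₂)) :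
    (p : ℤ) ^ k ∣ v * u' - u * v' := by
  have hpp : Prime (p : ℤ) := Nat.prime_iff_prime_int.1 hp.out
  have hcop : ∀ s : ℤ, ¬ (p : ℤ) ∣ s → IsCoprime ((p : ℤ) ^ k) s := fun s hs =>
    ((Prime.coprime_iff_not_dvd hpp).2 hs).pow_left
  -- Identify `x` with `x₁ + x₂√D`. After clearing denominators, `(u + v√D)(u' - v'√D) - (u -
  -- v√D)(u' + v'√D) = 2 (v u' - u v') √D` annihilates `x` modulo `p ^ k`; the two components of
  -- this relation are `e1` and `e2`.
  have e1 : (p : ℤ) ^ k ∣ 2 * (D * (x₂ * (v * u' - u * v'))) := by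
    obtain ⟨a, ha⟩ := hw
    obtain ⟨b, hb⟩ := hw'
    obtain ⟨m, hm⟩ := h₁
    obtain ⟨n, hn⟩ := h₂
    refine ⟨(u * u' + D * v * v') * m - D * (u * v' + v * u') * n -
      ((u * u' - D * v * v') * x₁ + (v * u' - u * v') * D * x₂) * a +
      ((u * u' - D * v * v') * x₁ - (v * u' - u * v') * D * x₂) * b, ?_⟩
    linear_combination (u * u' + D * v * v') * hm - D * (u * v' + v * u') * hn -
      ((u * u' - D * v * v') * x₁ + (v * u' - u * v') * D * x₂) * ha +
      ((u * u' - D * v * v') * x₁ - (v * u' - u * v') * D * x₂) * hb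
  have e2 : (p : ℤ) ^ k ∣ 2 * (x₁ * (v * u' - u * v')) := by
    obtain ⟨a, ha⟩ := hw
    obtain ⟨b, hb⟩ := hw'
    obtain ⟨m, hm⟩ := h₁
    obtain ⟨n, hn⟩ := h₂
    refine ⟨(u * u' + D * v * v') * n - (u * v' + v * u') * m -
      ((u * u' - D * v * v') * x₂ + (v * u' - u * v') * x₁) * a +
      ((u * u' - D * v * v') * x₂ - (v * u' - u * v') * x₁) * b, ?_⟩
    linear_combination (u * u' + D * v * v') * hn - (u * v' + v * u') * hm -
      ((u * u' - D * v * v') * x₂ + (v * u' - u * v') * x₁) * ha +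
      ((u * u' - D * v * v') * x₂ - (v * u' - u * v') * x₁) * hb
  have h2 := hcop 2 (not_dvd_two hp2)
  by_cases hx1 : (p : ℤ) ∣ x₁
  · have hx2 : ¬ (p : ℤ) ∣ x₂ := fun h => hx ⟨hx1, h⟩
    exact (hcop _ hx2).dvd_of_dvd_mul_left ((hcop _ hD).dvd_of_dvd_mul_left
      (h2.dvd_of_dvd_mul_left e1))
  · exact (hcop _ hx1).dvd_of_dvd_mul_left (h2.dvd_of_dvd_mul_left e2)

/-- The rotations indexed by `S` carry `x` to points that are distinct modulo `p ^ k` by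
`dvd_cross_of_dvd_sub`. The norm of `c` depends only on residues and is the same at all these
points, so each contributes a separate equal term to the total. -/
theorem card_mul_norm_sq_le [hp : Fact p.Prime] (hp2 : p ≠ 2) (hD : ¬ (p : ℤ) ∣ D)
    (h : IsThetaCoeff p k D r c) {x₁ x₂ : ℤ} (hx : ¬ ((p : ℤ) ∣ x₁ ∧ (p : ℤ) ∣ x₂))
    {ι : Type*} (S : Finset ι) (u v : ι → ℤ)
    (hS : ∀ i ∈ S, ¬ (p : ℤ) ∣ u i ^ 2 - D * v i ^ 2)
    (hinj : ∀ i ∈ S, ∀ j ∈ S, (p : ℤ) ^ k ∣ v i * u j - u i * v j → i = j) :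
    S.card * ‖c x₁ x₂‖ ^ 2 ≤
      ∑ y₁ ∈ Finset.range (p ^ k), ∑ y₂ ∈ Finset.range (p ^ k), ‖c y₁ y₂‖ ^ 2 := by
  choose! w l hw hl hc using h.rotate
  set X : ι → ℤ := fun i => w (u i) (v i) * ((u i ^ 2 + D * v i ^ 2) * x₁ + 2 * u i * v i * D * x₂)
  set Y : ι → ℤ := fun i => w (u i) (v i) * (2 * u i * v i * x₁ + (u i ^ 2 + D * v i ^ 2) * x₂)
  have : NeZero (p ^ k) := ⟨pow_ne_zero _ hp.out.ne_zero⟩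
  have hval : ∀ a : ℤ, (p : ℤ) ^ k ∣ (((a : ZMod (p ^ k)).val : ℕ) : ℤ) - a := by
    intro a
    have : ((p ^ k : ℕ) : ℤ) ∣ (((a : ZMod (p ^ k)).val : ℕ) : ℤ) - a := by
      rw [← ZMod.intCast_zmod_eq_zero_iff_dvd]
      simp
    exact_mod_cast this
  have hdvd : ∀ a b : ℤ, (a : ZMod (p ^ k)) = b → (p : ℤ) ^ k ∣ a - b := by
    intro a b hab
    have : ((p ^ k : ℕ) : ℤ) ∣ a - b := by
      rw [← ZMod.intCast_zmod_eq_zero_iff_dvd]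
      simp [hab]
    exact_mod_cast this
  have hinj' : Set.InjOn (fun i => ((X i : ZMod (p ^ k)), (Y i : ZMod (p ^ k)))) S := by
    intro i hi j hj hij
    rw [Prod.mk.injEq] at hij
    have hpow : (p : ℤ) ^ k ∣ ((p : ℤ) ^ k) ^ 2 := dvd_pow_self _ two_ne_zero
    exact hinj i hi j hj (dvd_cross_of_dvd_sub hp2 hD hx (hpow.trans (hw _ _ (hS i hi)))
      (hpow.trans (hw _ _ (hS j hj))) (hdvd _ _ hij.1) (hdvd _ _ hij.2))
  have hsum : ∑ y₁ ∈ Finset.range (p ^ k), ∑ y₂ ∈ Finset.range (p ^ k), ‖c y₁ y₂‖ ^ 2 =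
      ∑ z : ZMod (p ^ k) × ZMod (p ^ k), ‖c z.1.val z.2.val‖ ^ 2 := by
    rw [Fintype.sum_prod_type, sum_range_eq_sum_zmod]
    exact Finset.sum_congr rfl fun z _ => sum_range_eq_sum_zmod _ _
  rw [hsum]
  calc S.card * ‖c x₁ x₂‖ ^ 2 = ∑ i ∈ S, ‖c ((X i : ZMod (p ^ k)).val) ((Y i : ZMod (p ^ k)).val)‖ ^ 2 := by
        rw [← nsmul_eq_mul, ← Finset.sum_const]
        refine Finset.sum_congr rfl fun i hi => ?_
        rw [h.norm_congr (hval (X i)) (hval (Y i)), hc _ _ (hS i hi), norm_mul, hl _ _ (hS i hi),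
          one_mul]
    _ = ∑ z ∈ S.image fun i => ((X i : ZMod (p ^ k)), (Y i : ZMod (p ^ k))),
        ‖c z.1.val z.2.val‖ ^ 2 :=
          (Finset.sum_image (f := fun z : ZMod (p ^ k) × ZMod (p ^ k) => ‖c z.1.val z.2.val‖ ^ 2) hinj').symm
    _ ≤ _ := Finset.sum_le_univ_sum_of_nonneg fun z => by positivity

/-- A coefficient at a primitive point carries at most the share of a full orbit of the torus. -/
theorem mul_norm_sq_le [hp : Fact p.Prime] (hp2 : p ≠ 2) (hD : ¬ (p : ℤ) ∣ D)
    (h : IsThetaCoeff p (k + 1) D r c) {x₁ x₂ : ℤ} (hx : ¬ ((p : ℤ) ∣ x₁ ∧ (p : ℤ) ∣ x₂)) :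
    ((p - 1) * p ^ k : ℝ) * ‖c x₁ x₂‖ ^ 2 ≤
      ∑ y₁ ∈ Finset.range (p ^ (k + 1)), ∑ y₂ ∈ Finset.range (p ^ (k + 1)), ‖c y₁ y₂‖ ^ 2 := by
  have hpp : Prime (p : ℤ) := Nat.prime_iff_prime_int.1 hp.out
  set R : Finset ℕ := (Finset.range (p ^ (k + 1))).filter fun t : ℕ => ¬ (p : ℤ) ∣ (t : ℤ) ^ 2 - D
  have hR : p ^ (k + 1) ≤ R.card + 2 * p ^ k := by
    have h1 := Finset.card_filter_add_card_filter_not (s := Finset.range (p ^ (k + 1)))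
      (fun t : ℕ => (p : ℤ) ∣ (t : ℤ) ^ 2 - D)
    rw [Finset.card_range] at h1
    have h2 : ((Finset.range (p ^ (k + 1))).filter fun t : ℕ => (p : ℤ) ∣ (t : ℤ) ^ 2 - D).card ≤
        2 * p ^ k := by
      by_cases he : ∃ t₀ : ℤ, (p : ℤ) ∣ t₀ ^ 2 - D
      · obtain ⟨t₀, ht₀⟩ := he
        have hsub : ((Finset.range (p ^ (k + 1))).filter fun t : ℕ => (p : ℤ) ∣ (t : ℤ) ^ 2 - D) ⊆
            ((Finset.range (p ^ (1 + k))).filter fun t : ℕ => (p : ℤ) ^ 1 ∣ (t : ℤ) - t₀) ∪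
            ((Finset.range (p ^ (1 + k))).filter fun t : ℕ => (p : ℤ) ^ 1 ∣ (t : ℤ) - -t₀) := by
          intro t ht
          rw [Finset.mem_union, Finset.mem_filter, Finset.mem_filter, add_comm 1 k, ← and_or_left,
            pow_one, sub_neg_eq_add]
          rw [Finset.mem_filter] at ht
          refine ⟨ht.1, (hpp.dvd_or_dvd ?_).symm⟩
          have := dvd_sub ht.2 ht₀
          rwa [sub_sub_sub_cancel_right, sq_sub_sq] at this
        have hc := (Finset.card_le_card hsub).trans (Finset.card_union_le _ _)
        rw [card_filter_pow_dvd_sub p hp.out.ne_zero, card_filter_pow_dvd_sub p hp.out.ne_zero] at hc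
        lia
      · push Not at he
        rw [Finset.filter_false_of_mem fun (t : ℕ) _ => he t]
        simp
    lia
  -- Rotations are parametrized by points `(u : v)` of the projective line over `ℤ/p^(k+1)` with `u²
  -- - D v²` a unit. The chart `(t : 1)` loses at most two classes of `t` modulo `p`, the square
  -- roots of `D`; the remaining points `(1 : p s)` are all admissible. The total is at least
  -- `p^(k+1) - 2 p^k + p^k`.
  have hle := card_mul_norm_sq_le hp2 hD h hx (R.disjSum (Finset.range (p ^ k)))
    (Sum.elim (fun t => (t : ℤ)) (fun _ => 1)) (Sum.elim (fun _ => 1) fun s => p * (s : ℤ)) ?_ ?_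
  · refine le_trans ?_ hle
    rw [Finset.card_disjSum, Finset.card_range]
    apply mul_le_mul_of_nonneg_right _ (by positivity)
    have : ((p ^ (k + 1) : ℕ) : ℝ) ≤ ((R.card + 2 * p ^ k : ℕ) : ℝ) := by exact_mod_cast hR
    push_cast at this ⊢
    rw [pow_succ] at this
    linarith
  · rintro (t | s) hi
    · simpa [R] using (Finset.mem_filter.1 (Finset.inl_mem_disjSum.1 hi)).2
    · simp only [Sum.elim_inr]
      intro h1
      have h2 := dvd_add h1 (⟨D * p * s ^ 2, by ring⟩ : (p : ℤ) ∣ D * (p * s) ^ 2)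
      rw [sub_add_cancel, one_pow] at h2
      exact hpp.not_isUnit (isUnit_of_dvd_one h2)
  · have aux : ∀ n m t : ℕ, t < m → n < m → (m : ℤ) ∣ (t : ℤ) - n → t = n := by
      intro n m t ht hn hd
      have h3 := Int.eq_zero_of_abs_lt_dvd hd (by rw [abs_lt]; constructor <;> lia)
      lia
    rintro (t | s) hi (t' | s') hj hd
    · simp only [Sum.elim_inl, one_mul, mul_one] at hd
      have h1 := (Finset.mem_filter.1 (Finset.inl_mem_disjSum.1 hi)).1
      have h2 := (Finset.mem_filter.1 (Finset.inl_mem_disjSum.1 hj)).1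
      rw [aux _ _ _ (Finset.mem_range.1 h2) (Finset.mem_range.1 h1) (by exact_mod_cast hd)]
    · exfalso
      simp only [Sum.elim_inl, Sum.elim_inr, one_mul] at hd
      have h1 := dvd_add ((dvd_pow_self _ (Nat.succ_ne_zero k)).trans hd)
        (⟨t * s', by ring⟩ : (p : ℤ) ∣ t * (p * s'))
      rw [sub_add_cancel] at h1
      exact hpp.not_isUnit (isUnit_of_dvd_one h1)
    · exfalso
      simp only [Sum.elim_inl, Sum.elim_inr, one_mul] at hd
      have h1 := dvd_sub (⟨s * t', by ring⟩ : (p : ℤ) ∣ p * s * t')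
        ((dvd_pow_self _ (Nat.succ_ne_zero k)).trans hd)
      rw [sub_sub_cancel] at h1
      exact hpp.not_isUnit (isUnit_of_dvd_one h1)
    · simp only [Sum.elim_inr, one_mul, mul_one] at hd
      rw [← mul_sub, pow_succ', mul_dvd_mul_iff_left hpp.ne_zero] at hd
      have h1 := Finset.mem_range.1 (Finset.inr_mem_disjSum.1 hi)
      have h2 := Finset.mem_range.1 (Finset.inr_mem_disjSum.1 hj)
      rw [aux _ _ _ h1 h2 (by exact_mod_cast hd)]

end IsThetaCoeff

/-! ### Quadratic Gauss sums and van der Corput differencing -/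

/-- In the product with the conjugate, substituting `t + s` for `t` makes the phase linear in `s`,
so only `t = 0` survives the summation over `s`. -/
theorem norm_sq_sum_quadratic {p : ℕ} [hp : Fact p.Prime] (hp2 : p ≠ 2) {a : ZMod p} (ha : a ≠ 0)
    (b : ZMod p) : ‖∑ t : ZMod p, (ZMod.stdAddChar (a * t ^ 2 + b * t) : ℂ)‖ ^ 2 = p := by
  have h2 : (2 : ZMod p) ≠ 0 := by
    intro h
    have : ((2 : ℤ) : ZMod p) = 0 := by exact_mod_cast h
    exact not_dvd_two hp2 ((ZMod.intCast_zmod_eq_zero_iff_dvd 2 p).1 this)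
  have key : (∑ t : ZMod p, (ZMod.stdAddChar (a * t ^ 2 + b * t) : ℂ)) *
      starRingEnd ℂ (∑ t : ZMod p, (ZMod.stdAddChar (a * t ^ 2 + b * t) : ℂ)) = p := by
    rw [map_sum, Finset.sum_mul_sum, Finset.sum_comm]
    have h1 : ∀ s : ZMod p, ∑ t : ZMod p, (ZMod.stdAddChar (a * t ^ 2 + b * t) : ℂ) *
        starRingEnd ℂ (ZMod.stdAddChar (a * s ^ 2 + b * s) : ℂ) =
        ∑ t : ZMod p, (ZMod.stdAddChar (a * t ^ 2 + b * t) : ℂ) *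
          ZMod.stdAddChar (s * (2 * a * t - 0)) := by
      intro s
      rw [← Equiv.sum_comp (Equiv.addRight s)]
      refine Finset.sum_congr rfl fun t _ => ?_
      rw [← AddChar.map_neg_eq_conj, ← AddChar.map_add_eq_mul, ← AddChar.map_add_eq_mul]
      congr 1
      simp only [Equiv.coe_addRight]
      ring
    simp_rw [h1]
    rw [Finset.sum_comm]
    simp_rw [← Finset.mul_sum, AddChar.sum_mulShift _ (ZMod.isPrimitive_stdAddChar p), sub_zero]
    rw [Finset.sum_eq_single 0]
    · simp [ZMod.card]
    · intro t _ ht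
      rw [if_neg (mul_ne_zero (mul_ne_zero h2 ha) ht)]
      simp
    · simp
  rw [Complex.mul_conj, Complex.normSq_eq_norm_sq] at key
  exact_mod_cast key

theorem sum_range_mul_of_periodic {E : Type*} [AddCommMonoid E] {p : ℕ} {f : ℤ → E}
    (hf : ∀ t, f (t + p) = f t) (n : ℕ) :
    ∑ t ∈ Finset.range (p * n), f t = n • ∑ t ∈ Finset.range p, f t := by
  have hf' : ∀ (n : ℕ) t, f (t + p * n) = f t := by
    intro n
    induction n with
    | zero => simp
    | succ n ih => intro t; rw [← ih t, ← hf (t + p * n)]; congr 1; push_cast; ring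
  induction n with
  | zero => simp
  | succ n ih =>
    rw [Nat.mul_succ, Finset.sum_range_add, ih, succ_nsmul]
    congr 1
    refine Finset.sum_congr rfl fun t _ => ?_
    rw [← hf' n t]
    congr 1
    push_cast
    ring

theorem sum_range_add_of_periodic {E : Type*} [AddCommMonoid E] {n : ℕ} [NeZero n] {f : ℤ → E}
    (hf : ∀ t, f (t + n) = f t) (h : ℤ) :
    ∑ t ∈ Finset.range n, f (t + h) = ∑ t ∈ Finset.range n, f t := by
  have hf1 : ∀ s t : ℤ, (n : ℤ) ∣ s - t → f s = f t := by
    rintro s t ⟨a, ha⟩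
    obtain rfl : s = t + a * n := by linear_combination ha
    exact (Function.Periodic.int_mul hf a) t
  rw [sum_range_eq_sum_zmod n fun t => f (t + h), sum_range_eq_sum_zmod n fun t => f t]
  conv_rhs => rw [← Equiv.sum_comp (Equiv.addRight (h : ZMod n))]
  refine Finset.sum_congr rfl fun z _ => hf1 _ _ ?_
  rw [← ZMod.intCast_zmod_eq_zero_iff_dvd]
  simp

theorem norm_sum_range_quadratic {p : ℕ} [hp : Fact p.Prime] (hp2 : p ≠ 2) {a : ℤ}
    (ha : ¬ (p : ℤ) ∣ a) (b : ℤ) (n : ℕ) :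
    ‖∑ t ∈ Finset.range (p * n), unitExp p (a * (t : ℤ) ^ 2 + b * t)‖ = n * Real.sqrt p := by
  rw [sum_range_mul_of_periodic (f := fun t : ℤ => unitExp p (a * t ^ 2 + b * t)) (p := p),
    sum_range_eq_sum_zmod p fun t => unitExp p (a * (t : ℤ) ^ 2 + b * t)]
  · rw [nsmul_eq_mul, norm_mul, Complex.norm_natCast]
    congr 1
    have ha' : (a : ZMod p) ≠ 0 := by rwa [Ne, ZMod.intCast_zmod_eq_zero_iff_dvd]
    rw [← norm_sq_sum_quadratic hp2 ha' b, Real.sqrt_sq (norm_nonneg _)]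
    congr 1
    refine Finset.sum_congr rfl fun z _ => ?_
    rw [← stdAddChar_intCast]
    simp
  · intro t
    rw [unitExp_eq_iff hp.out.ne_zero]
    exact ⟨a * (2 * t + p) + b, by ring⟩

/-- A Weyl sum of degree three, by van der Corput differencing. -/
theorem norm_sq_sum_le_of_difference {p m : ℕ} [hp : Fact p.Prime] (hp2 : p ≠ 2) {f : ℤ → ℂ}
    {F : ℝ} (hper : ∀ t, f (t + (p ^ (m + 1) : ℕ)) = f t) (hF : ∀ t, ‖f t‖ = F)
    (hdiff : ∀ h : ℤ, ¬ (p : ℤ) ∣ h → ∃ κ : ℂ, ∃ a b : ℤ, ‖κ‖ = 1 ∧ ¬ (p : ℤ) ∣ a ∧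
      ∀ t : ℤ, f (t + (p : ℤ) ^ m * h) = κ * unitExp p (a * t ^ 2 + b * t) * f t) :
    ‖∑ t ∈ Finset.range (p ^ (m + 1)), f t‖ ^ 2 ≤
      (p : ℝ) ^ (2 * m) * (p + (p - 1) * Real.sqrt p) * F ^ 2 := by
  have hp0 : 0 < (p : ℝ) := by exact_mod_cast hp.out.pos
  have hF0 : 0 ≤ F := (norm_nonneg _).trans (hF 0).le
  have : NeZero (p ^ (m + 1)) := ⟨pow_ne_zero _ hp.out.ne_zero⟩
  set P : ℕ := p ^ (m + 1) with hP
  set S := ∑ t ∈ Finset.range P, f t with hS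
  -- Only the `p` shifts by multiples of `p ^ m` are averaged. For these, the correlation of two
  -- different shifts is a complete quadratic sum modulo `p`, repeated `p ^ m` times.
  set G : ℤ → ℂ := fun t => ∑ h ∈ Finset.range p, f (t + (p : ℤ) ^ m * h) with hG
  have h1 : (p : ℂ) * S = ∑ t ∈ Finset.range P, G t := by
    rw [hG, Finset.sum_comm]
    simp_rw [sum_range_add_of_periodic hper]
    simp [hS]
  have h2 : (p : ℝ) ^ 2 * ‖S‖ ^ 2 ≤ P * ∑ t ∈ Finset.range P, ‖G t‖ ^ 2 := by
    rw [← mul_pow, ← Complex.norm_natCast, ← norm_mul, h1]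
    calc _ ≤ (∑ t ∈ Finset.range P, ‖G t‖) ^ 2 := by
          gcongr; exact norm_sum_le _ _
      _ ≤ _ := by
          have := sq_sum_le_card_mul_sum_sq (s := Finset.range P) (f := fun t : ℕ => ‖G t‖)
          rwa [Finset.card_range] at this
  have hcorr : ∀ h h' : ℕ, h < p → h' < p → ‖∑ t ∈ Finset.range P, f (t + (p : ℤ) ^ m * h) *
      starRingEnd ℂ (f (t + (p : ℤ) ^ m * h'))‖ ≤
      if h = h' then P * F ^ 2 else (p : ℝ) ^ m * Real.sqrt p * F ^ 2 := by
    intro h h' hh hh'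
    split_ifs with he
    · refine (norm_sum_le _ _).trans ?_
      simp_rw [norm_mul, RCLike.norm_conj, hF]
      simp [pow_two]
    · have hd : ¬ (p : ℤ) ∣ (h : ℤ) - h' := by
        intro hd
        have := Int.eq_zero_of_abs_lt_dvd hd (by rw [abs_lt]; constructor <;> lia)
        lia
      obtain ⟨κ, a, b, hκ, ha, hf⟩ := hdiff _ hd
      have hs := sum_range_add_of_periodic (n := P)
        (f := fun t : ℤ => f (t + (p : ℤ) ^ m * (h - h')) * starRingEnd ℂ (f t))
        (by
          intro t
          rw [hper, add_right_comm, hper]) ((p : ℤ) ^ m * h')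
      have e1 : ∀ t : ℤ, t + (p : ℤ) ^ m * h' + (p : ℤ) ^ m * (h - h') = t + (p : ℤ) ^ m * h := by
        intro t; ring
      simp only [e1] at hs
      rw [hs]
      have e2 : ∀ t : ℤ, f (t + (p : ℤ) ^ m * (h - h')) * starRingEnd ℂ (f t) =
          κ * (F ^ 2 : ℝ) * unitExp p (a * t ^ 2 + b * t) := by
        intro t
        rw [hf, mul_assoc, Complex.mul_conj, Complex.normSq_eq_norm_sq, hF]
        ring
      simp_rw [e2]
      rw [← Finset.mul_sum, norm_mul, norm_mul, hκ, hP, pow_succ' p m, norm_sum_range_quadratic hp2 ha,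
        Complex.norm_real, Real.norm_of_nonneg (by positivity)]
      push_cast
      apply le_of_eq
      ring
  have h3 : ∑ t ∈ Finset.range P, ‖G t‖ ^ 2 ≤
      p * (P * F ^ 2) + p * (p - 1) * ((p : ℝ) ^ m * Real.sqrt p * F ^ 2) := by
    have e1 : ((∑ t ∈ Finset.range P, ‖G t‖ ^ 2 : ℝ) : ℂ) =
        ∑ h ∈ Finset.range p, ∑ h' ∈ Finset.range p, ∑ t ∈ Finset.range P,
          f (t + (p : ℤ) ^ m * h) * starRingEnd ℂ (f (t + (p : ℤ) ^ m * h')) := by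
      push_cast
      have : ∀ t : ℕ, ((‖G t‖ : ℝ) : ℂ) ^ 2 = ∑ h ∈ Finset.range p, ∑ h' ∈ Finset.range p,
          f (t + (p : ℤ) ^ m * h) * starRingEnd ℂ (f (t + (p : ℤ) ^ m * h')) := by
        intro t
        rw [← Complex.mul_conj', hG, map_sum, Finset.sum_mul_sum]
      simp_rw [this]
      rw [Finset.sum_comm]
      exact Finset.sum_congr rfl fun h _ => Finset.sum_comm
    have e2 : ∑ t ∈ Finset.range P, ‖G t‖ ^ 2 =
        ‖((∑ t ∈ Finset.range P, ‖G t‖ ^ 2 : ℝ) : ℂ)‖ := by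
      rw [Complex.norm_real, Real.norm_of_nonneg (Finset.sum_nonneg fun _ _ => by positivity)]
    rw [e2, e1]
    calc _ ≤ ∑ h ∈ Finset.range p, ∑ h' ∈ Finset.range p,
          if h = h' then P * F ^ 2 else (p : ℝ) ^ m * Real.sqrt p * F ^ 2 := by
          refine (norm_sum_le _ _).trans (Finset.sum_le_sum fun h hh => ?_)
          refine (norm_sum_le _ _).trans (Finset.sum_le_sum fun h' hh' => ?_)
          exact hcorr h h' (Finset.mem_range.1 hh) (Finset.mem_range.1 hh')
      _ = ∑ h ∈ Finset.range p, (P * F ^ 2 + (p - 1) * ((p : ℝ) ^ m * Real.sqrt p * F ^ 2)) := by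
          refine Finset.sum_congr rfl fun h hh => ?_
          rw [← Finset.add_sum_erase _ _ hh, if_pos rfl, Finset.sum_congr rfl
            (g := fun _ => (p : ℝ) ^ m * Real.sqrt p * F ^ 2)
            fun h' hh' => if_neg (Finset.ne_of_mem_erase hh').symm, Finset.sum_const,
            Finset.card_erase_of_mem hh, Finset.card_range, nsmul_eq_mul,
            Nat.cast_sub hp.out.one_le, Nat.cast_one]
      _ = _ := by
          rw [Finset.sum_const, Finset.card_range, nsmul_eq_mul]; ring
  have h4 := h2.trans (mul_le_mul_of_nonneg_left h3 (Nat.cast_nonneg P))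
  refine le_of_mul_le_mul_left (h4.trans_eq ?_) (pow_pos hp0 2)
  rw [hP]
  push_cast
  ring

/-! ### The estimate on a line `x₂ = y` -/

namespace IsThetaCoeff

variable {p k : ℕ} {D r : ℤ} {c : ℤ → ℤ → ℂ}

theorem exists_mul_sub_dvd {p : ℕ} [hp : Fact p.Prime] {a : ℤ} (ha : ¬ (p : ℤ) ∣ a) (n : ℕ)
    (t : ℤ) : ∃ s e : ℤ, a * s = t + (p : ℤ) ^ n * e := by
  have hpp : Prime (p : ℤ) := Nat.prime_iff_prime_int.1 hp.out
  obtain ⟨x, y, hxy⟩ := ((Prime.coprime_iff_not_dvd hpp).2 ha).pow_left (m := n)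
  exact ⟨t * y, -(t * x), by linear_combination t * hxy⟩

theorem not_dvd_one_sub {p : ℕ} [hp : Fact p.Prime] {D v : ℤ} (hv : (p : ℤ) ∣ v) :
    ¬ (p : ℤ) ∣ 1 ^ 2 - D * v ^ 2 := by
  have hpp : Prime (p : ℤ) := Nat.prime_iff_prime_int.1 hp.out
  intro h1
  have h2 := dvd_add h1 (dvd_mul_of_dvd_right (dvd_pow hv two_ne_zero) D)
  rw [sub_add_cancel, one_pow] at h2
  exact hpp.not_isUnit (isUnit_of_dvd_one h2)

/-- With `Q = p ^ (m + 1)`, the rotation with `(u, v) = (1, Q s)` changes the second coordinate of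
`(0, y)` only by multiples of `Q²`, which is the full modulus, and moves the first one to `2 D y s
Q`. Since `2 D y` is a unit modulo `p`, every `Q t` is reached. -/
theorem norm_vertical [hp : Fact p.Prime] (hp2 : p ≠ 2) (hD : ¬ (p : ℤ) ∣ D) {m : ℕ}
    (h : IsThetaCoeff p (2 * (m + 1)) D r c) {y : ℤ} (hy : ¬ (p : ℤ) ∣ y) (t : ℤ) :
    ‖c ((p : ℤ) ^ (m + 1) * t) y‖ = ‖c 0 y‖ := by
  have hpp : Prime (p : ℤ) := Nat.prime_iff_prime_int.1 hp.out
  obtain ⟨s, e, hs⟩ := exists_mul_sub_dvd (p := p) (a := 2 * D * y) (by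
    intro h1
    rcases hpp.dvd_or_dvd h1 with h2 | h2
    · rcases hpp.dvd_or_dvd h2 with h3 | h3
      · exact not_dvd_two hp2 h3
      · exact hD h3
    · exact hy h2) (m + 1) t
  obtain ⟨w, l, ⟨z, hz⟩, hl, hc⟩ := h.rotate 1 ((p : ℤ) ^ (m + 1) * s)
    (not_dvd_one_sub (dvd_mul_of_dvd_left (dvd_pow_self _ (Nat.succ_ne_zero m)) _))
  have h1 := congrArg norm (hc 0 y)
  rw [norm_mul, hl, one_mul] at h1
  rw [← h1]
  have hq : (p : ℤ) ^ (2 * (m + 1)) = ((p : ℤ) ^ (m + 1)) ^ 2 := by ring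
  rw [hq] at hz
  set Q := (p : ℤ) ^ (m + 1)
  apply h.norm_congr
  · rw [hq]
    refine ⟨-e - 2 * Q * s * D * y * (w * D * s ^ 2 + Q ^ 2 * z), ?_⟩
    linear_combination -2 * Q * s * D * y * hz - Q * hs
  · rw [hq]
    refine ⟨-y * (2 * w * D * s ^ 2 + Q ^ 2 * z), ?_⟩
    linear_combination -y * hz

/-- A rotation with `v` of order `p ^ (2 m + 1)` realizes the shift of `t` by `p ^ m g` up to a
translation by `q ℤ²`. The second component of that translation is linear in `t`, so its phase is
quadratic in `t` modulo `p`, as `norm_sq_sum_le_of_difference` requires. The trivial bound would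
have `p²` in place of `p + (p - 1)√p`. -/
theorem norm_sq_sum_vertical_le [hp : Fact p.Prime] (hp2 : p ≠ 2) (hD : ¬ (p : ℤ) ∣ D)
    (hr : ¬ (p : ℤ) ∣ r) {m : ℕ}
    (h : IsThetaCoeff p (2 * (m + 1)) D r c) {y : ℤ} (hy : ¬ (p : ℤ) ∣ y) :
    ‖∑ t ∈ Finset.range (p ^ (m + 1)), unitExp ((p ^ (2 * (m + 1))) ^ 2)
      (r * ((p : ℤ) ^ (m + 1) * t) * y) * c ((p : ℤ) ^ (m + 1) * t) y‖ ^ 2 ≤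
      (p : ℝ) ^ (2 * m) * (p + (p - 1) * Real.sqrt p) * ‖c 0 y‖ ^ 2 := by
  have hpp : Prime (p : ℤ) := Nat.prime_iff_prime_int.1 hp.out
  have hq0 : (p ^ (2 * (m + 1))) ^ 2 ≠ 0 := pow_ne_zero _ (pow_ne_zero _ hp.out.ne_zero)
  apply norm_sq_sum_le_of_difference hp2 (f := fun t : ℤ => unitExp ((p ^ (2 * (m + 1))) ^ 2)
      (r * ((p : ℤ) ^ (m + 1) * t) * y) * c ((p : ℤ) ^ (m + 1) * t) y)
  · intro t
    have h1 := h.translate ((p : ℤ) ^ (m + 1) * t) y 1 0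
    have e1 : (p : ℤ) ^ (m + 1) * (t + (p ^ (m + 1) : ℕ)) =
        (p : ℤ) ^ (m + 1) * t + (p : ℤ) ^ (2 * (m + 1)) * 1 := by
      push_cast; ring
    have e2 : y = y + (p : ℤ) ^ (2 * (m + 1)) * 0 := by ring
    rw [← e2] at h1
    simp only [e1]
    rw [h1, ← mul_assoc, ← unitExp_add]
    congr 2
    ring
  · intro t
    rw [norm_mul, norm_unitExp, one_mul, h.norm_vertical hp2 hD hy]
  · intro g hg
    -- Solving `2 D y s ≡ g` modulo `p` alone is enough: the error `p e`, multiplied by `p ^ (2 m +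
    -- 1)`, is a multiple of `q = p ^ (2 m + 2)`.
    obtain ⟨s, e, hs⟩ := exists_mul_sub_dvd (p := p) (a := 2 * D * y) (by
      intro h1
      rcases hpp.dvd_or_dvd h1 with h2 | h2
      · rcases hpp.dvd_or_dvd h2 with h3 | h3
        · exact not_dvd_two hp2 h3
        · exact hD h3
      · exact hy h2) 1 g
    have hps : ¬ (p : ℤ) ∣ s := by
      intro h1
      have h2 : (p : ℤ) ∣ 2 * D * y * s - (p : ℤ) ^ 1 * e :=
        dvd_sub (dvd_mul_of_dvd_right h1 _) ⟨e, by ring⟩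
      rw [hs, add_sub_cancel_right] at h2
      exact hg h2
    obtain ⟨w, l, ⟨z, hz⟩, hl, hc⟩ := h.rotate 1 ((p : ℤ) ^ (2 * m + 1) * s)
      (not_dvd_one_sub (dvd_mul_of_dvd_left (dvd_pow_self _ (Nat.succ_ne_zero _)) _))
    have hpw : ¬ (p : ℤ) ∣ w := by
      intro h1
      have h2 : (p : ℤ) ∣ 1 := by
        have h3 : (p : ℤ) ∣ w * (1 ^ 2 - D * ((p : ℤ) ^ (2 * m + 1) * s) ^ 2) - ((p : ℤ) ^ (2 * (m + 1))) ^ 2 * z :=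
          dvd_sub (dvd_mul_of_dvd_left h1 _) (dvd_mul_of_dvd_left (dvd_pow
            (dvd_pow_self _ (by lia)) two_ne_zero) _)
        rwa [← hz, sub_sub_cancel] at h3
      exact hpp.not_isUnit (isUnit_of_dvd_one h2)
    set P := (p : ℤ) ^ m with hP
    have hq : (p : ℤ) ^ (2 * (m + 1)) = p ^ 2 * P ^ 2 := by rw [hP]; ring
    have hv : (p : ℤ) ^ (2 * m + 1) = p * P ^ 2 := by rw [hP]; ring
    have hu : (p : ℤ) ^ (m + 1) = p * P := by rw [hP]; ring
    rw [hv, hq] at hz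
    rw [hv] at hc
    have htr := h.translate
    rw [hq] at htr
    rw [hu]
    -- With `v = p P² s` one has `w (1 + D v²) = 1 + p² P⁴ α`; `β` becomes, up to the factor `-r`,
    -- the leading coefficient of the quadratic phase; `e'` is the part of the first translation
    -- component that does not depend on `t`, including the deviation of `w` from `1`. The terms
    -- linear in `t` that contain `α` cancel between the two components.
    obtain ⟨α, hα⟩ : ∃ α, α = 2 * w * D * s ^ 2 + (p : ℤ) ^ 2 * z := ⟨_, rfl⟩
    obtain ⟨β, hβ⟩ : ∃ β, β = 2 * w * s := ⟨_, rfl⟩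
    obtain ⟨e', he'⟩ : ∃ e', e' = e * w + g * (w * D * p * P ^ 4 * s ^ 2 + (p : ℤ) ^ 3 * P ^ 4 * z) :=
      ⟨_, rfl⟩
    refine ⟨l * unitExp ((p ^ (2 * (m + 1))) ^ 2)
      (r * (p * P ^ 2 * g * y + p ^ 2 * P ^ 2 * e' * y - p ^ 3 * P ^ 6 * α * y * g)),
      -(r * β), -(r * β * P * g), ?_, ?_, ?_⟩
    · rw [norm_mul, hl, norm_unitExp, one_mul]
    · rw [dvd_neg, hβ]
      intro h1
      rcases hpp.dvd_or_dvd h1 with h2 | h2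
      · exact hr h2
      rcases hpp.dvd_or_dvd h2 with h3 | h3
      · rcases hpp.dvd_or_dvd h3 with h4 | h4
        · exact not_dvd_two hp2 h4
        · exact hpw h4
      · exact hps h3
    · intro t
      have h1 := hc (p * P * t) y
      have h2 := htr (p * P * (t + P * g)) y (e' + p * P ^ 3 * α * t) (P * β * t + P ^ 2 * α * y)
      have e1 : w * ((1 ^ 2 + D * (p * P ^ 2 * s) ^ 2) * (p * P * t) + 2 * 1 * (p * P ^ 2 * s) * D * y) =
          p * P * (t + P * g) + p ^ 2 * P ^ 2 * (e' + p * P ^ 3 * α * t) := by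
        rw [he', hα]
        linear_combination (p * P * t + p * P ^ 2 * g) * hz + w * p * P ^ 2 * hs
      have e2 : w * (2 * 1 * (p * P ^ 2 * s) * (p * P * t) + (1 ^ 2 + D * (p * P ^ 2 * s) ^ 2) * y) =
          y + p ^ 2 * P ^ 2 * (P * β * t + P ^ 2 * α * y) := by
        rw [hα, hβ]
        linear_combination y * hz
      rw [e1, e2, h2] at h1
      have h3 : c (p * P * (t + P * g)) y = unitExp ((p ^ (2 * (m + 1))) ^ 2)
          (-(r * (p ^ 2 * P ^ 2) * ((P * β * t + P ^ 2 * α * y) * (p * P * (t + P * g)) -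
            (e' + p * P ^ 3 * α * t) * y))) * (l * c (p * P * t) y) := by
        rw [← h1, ← mul_assoc, ← unitExp_add, neg_add_cancel,
          (unitExp_eq_one_iff hq0 0).2 (dvd_zero _), one_mul]
      have h4 : unitExp p (-(r * β) * t ^ 2 + -(r * β * P * g) * t) =
          unitExp ((p ^ (2 * (m + 1))) ^ 2) (p ^ 3 * P ^ 4 * (-(r * β) * t ^ 2 + -(r * β * P * g) * t)) := by
        rw [← unitExp_mul_mul (d := p ^ 3 * (p ^ m) ^ 4) (mul_ne_zero (pow_ne_zero _ hp.out.ne_zero)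
          (pow_ne_zero _ (pow_ne_zero _ hp.out.ne_zero)))]
        congr 1
        · ring
      rw [h3, h4]
      have h5 : unitExp ((p ^ (2 * (m + 1))) ^ 2) (r * (p * P * (t + P * g)) * y) *
          unitExp ((p ^ (2 * (m + 1))) ^ 2)
          (-(r * (p ^ 2 * P ^ 2) * ((P * β * t + P ^ 2 * α * y) * (p * P * (t + P * g)) -
            (e' + p * P ^ 3 * α * t) * y))) =
          unitExp ((p ^ (2 * (m + 1))) ^ 2)
            (r * (p * P ^ 2 * g * y + p ^ 2 * P ^ 2 * e' * y - p ^ 3 * P ^ 6 * α * y * g)) *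
          unitExp ((p ^ (2 * (m + 1))) ^ 2) (p ^ 3 * P ^ 4 * (-(r * β) * t ^ 2 + -(r * β * P * g) * t)) *
          unitExp ((p ^ (2 * (m + 1))) ^ 2) (r * (p * P * t) * y) := by
        rw [← unitExp_add, ← unitExp_add, ← unitExp_add]
        congr 1
        ring
      linear_combination (l * c (p * P * t) y) * h5

theorem five_le [hp : Fact p.Prime] (hp3 : 3 < p) : 5 ≤ p := by
  by_contra! h
  obtain rfl : p = 4 := by lia
  exact absurd hp.out (by norm_num)

/-- From `√p ≤ p - 2` the right side exceeds `(p - 1)√p` by at least `2 (p - 1)`, which is at least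
`p`. The inequality is false for `p = 3`. -/
theorem add_mul_sqrt_le [hp : Fact p.Prime] (hp3 : 3 < p) :
    (p + (p - 1) * Real.sqrt p : ℝ) ≤ (p - 1) * p := by
  have h5 : (5 : ℝ) ≤ p := by exact_mod_cast five_le hp3
  have h1 : Real.sqrt p ≤ p - 2 := by
    rw [Real.sqrt_le_left (by linarith)]
    nlinarith
  nlinarith

/-- Only the `p`-divisible points contribute: pass to the coefficients at `p x`. -/
theorem norm_sq_sum_le_of_descend [hp : Fact p.Prime]
    (ih : ∀ c, IsThetaCoeff p k D r c → ∀ y : ℤ,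
      ‖∑ x ∈ Finset.range (p ^ k), unitExp ((p ^ k) ^ 2) (r * x * y) * c x y‖ ^ 2 ≤
      ∑ y₁ ∈ Finset.range (p ^ k), ∑ y₂ ∈ Finset.range (p ^ k), ‖c y₁ y₂‖ ^ 2)
    (h : IsThetaCoeff p (k + 1) D r c) (y : ℤ)
    (h0 : ∀ x : ℤ, ¬ (p : ℤ) ∣ x → c x (p * y) = 0) :
    ‖∑ x ∈ Finset.range (p ^ (k + 1)), unitExp ((p ^ (k + 1)) ^ 2) (r * x * (p * y)) *
      c x (p * y)‖ ^ 2 ≤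
      ∑ y₁ ∈ Finset.range (p ^ (k + 1)), ∑ y₂ ∈ Finset.range (p ^ (k + 1)), ‖c y₁ y₂‖ ^ 2 := by
  have hinj : Set.InjOn (fun x : ℕ => p * x) (Finset.range (p ^ k)) := fun a _ b _ hab =>
    Nat.eq_of_mul_eq_mul_left hp.out.pos hab
  have hsub : (Finset.range (p ^ k)).image (fun x : ℕ => p * x) ⊆ Finset.range (p ^ (k + 1)) := by
    intro x hx
    obtain ⟨a, ha, rfl⟩ := Finset.mem_image.1 hx
    rw [Finset.mem_range] at ha ⊢
    rw [pow_succ']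
    exact Nat.mul_lt_mul_of_pos_left ha hp.out.pos
  have h1 := ih _ (h.descend hp.out.ne_zero) y
  have e1 : ∑ x ∈ Finset.range (p ^ (k + 1)), unitExp ((p ^ (k + 1)) ^ 2) (r * x * (p * y)) *
      c x (p * y) = ∑ x ∈ Finset.range (p ^ k), unitExp ((p ^ k) ^ 2) (r * x * y) *
        c (p * x) (p * y) := by
    rw [← Finset.sum_subset hsub, Finset.sum_image hinj]
    · refine Finset.sum_congr rfl fun x _ => ?_
      rw [← unitExp_mul_mul (pow_ne_zero 2 hp.out.ne_zero) ((p ^ k) ^ 2)]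
      push_cast
      congr 2 <;> ring
    · intro x hx hx'
      rw [h0, mul_zero]
      rintro ⟨a, ha⟩
      apply hx'
      have ha' : p ∣ x := by exact_mod_cast Dvd.intro _ ha.symm
      obtain ⟨b, rfl⟩ := ha'
      rw [Finset.mem_image]
      rw [Finset.mem_range, pow_succ'] at hx
      exact ⟨b, Finset.mem_range.2 (Nat.lt_of_mul_lt_mul_left hx), rfl⟩
  rw [e1]
  refine h1.trans ?_
  calc _ = ∑ y₁ ∈ (Finset.range (p ^ k)).image (fun x : ℕ => p * x),
        ∑ y₂ ∈ (Finset.range (p ^ k)).image (fun x : ℕ => p * x), ‖c y₁ y₂‖ ^ 2 := by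
        rw [Finset.sum_image hinj]
        refine Finset.sum_congr rfl fun x _ => ?_
        rw [Finset.sum_image hinj]
        push_cast
        rfl
    _ ≤ ∑ y₁ ∈ (Finset.range (p ^ k)).image (fun x : ℕ => p * x),
        ∑ y₂ ∈ Finset.range (p ^ (k + 1)), ‖c y₁ y₂‖ ^ 2 :=
        Finset.sum_le_sum fun _ _ => Finset.sum_le_sum_of_subset_of_nonneg hsub
          fun _ _ _ => by positivity
    _ ≤ _ := Finset.sum_le_sum_of_subset_of_nonneg hsub
          fun _ _ _ => Finset.sum_nonneg fun _ _ => by positivity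

/-- The exceptional case: `p ^ (m + 1)` points may carry mass, too many for Cauchy–Schwarz. The
saving in `norm_sq_sum_vertical_le` is compared, through `add_mul_sqrt_le`, with the share of the
orbit of the primitive point `(0, y)`. -/
theorem norm_sq_sum_le_of_even [hp : Fact p.Prime] (hp3 : 3 < p) (hD : ¬ (p : ℤ) ∣ D)
    (hr : ¬ (p : ℤ) ∣ r) {m : ℕ} (h : IsThetaCoeff p (m + m + 1 + 1) D r c) {y : ℤ}
    (hy : ¬ (p : ℤ) ∣ y) (h0 : ∀ x : ℤ, ¬ (p : ℤ) ^ (m + 1) ∣ x → c x y = 0) :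
    ‖∑ x ∈ Finset.range (p ^ (m + m + 1 + 1)), unitExp ((p ^ (m + m + 1 + 1)) ^ 2) (r * x * y) *
      c x y‖ ^ 2 ≤ ∑ y₁ ∈ Finset.range (p ^ (m + m + 1 + 1)),
        ∑ y₂ ∈ Finset.range (p ^ (m + m + 1 + 1)), ‖c y₁ y₂‖ ^ 2 := by
  have hk : m + m + 1 + 1 = 2 * (m + 1) := by ring
  have hpos : 0 < p ^ (m + 1) := pow_pos hp.out.pos _
  have e1 : ∑ x ∈ Finset.range (p ^ (m + m + 1 + 1)),
      unitExp ((p ^ (m + m + 1 + 1)) ^ 2) (r * x * y) * c x y =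
      ∑ t ∈ Finset.range (p ^ (m + 1)), unitExp ((p ^ (2 * (m + 1))) ^ 2)
      (r * ((p : ℤ) ^ (m + 1) * t) * y) * c ((p : ℤ) ^ (m + 1) * t) y := by
    have hinj : Set.InjOn (fun x : ℕ => p ^ (m + 1) * x) (Finset.range (p ^ (m + 1))) :=
      fun a _ b _ hab => Nat.eq_of_mul_eq_mul_left hpos hab
    have hq : p ^ (m + m + 1 + 1) = p ^ (m + 1) * p ^ (m + 1) := by ring
    rw [← Finset.sum_subset (s₁ := (Finset.range (p ^ (m + 1))).image fun x : ℕ => p ^ (m + 1) * x),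
      Finset.sum_image hinj]
    · refine Finset.sum_congr rfl fun x _ => ?_
      rw [hk]
      push_cast
      rfl
    · intro x hx
      obtain ⟨a, ha, rfl⟩ := Finset.mem_image.1 hx
      rw [Finset.mem_range] at ha ⊢
      rw [hq]
      exact Nat.mul_lt_mul_of_pos_left ha hpos
    · intro x hx hx'
      rw [h0, mul_zero]
      intro hd
      apply hx'
      have ha' : p ^ (m + 1) ∣ x := by exact_mod_cast hd
      obtain ⟨b, rfl⟩ := ha'
      rw [Finset.mem_image]
      rw [Finset.mem_range, hq] at hx
      exact ⟨b, Finset.mem_range.2 (Nat.lt_of_mul_lt_mul_left hx), rfl⟩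
  have h1 := (hk ▸ h : IsThetaCoeff p (2 * (m + 1)) D r c).norm_sq_sum_vertical_le (by lia) hD hr hy
  have h2 := h.mul_norm_sq_le (by lia) hD (x₁ := 0) (x₂ := y) fun hxy => hy hxy.2
  rw [e1]
  refine h1.trans (le_trans ?_ h2)
  apply mul_le_mul_of_nonneg_right _ (by positivity)
  calc _ ≤ (p : ℝ) ^ (2 * m) * ((p - 1) * p) :=
        mul_le_mul_of_nonneg_left (add_mul_sqrt_le hp3) (by positivity)
    _ = _ := by ring

/-- Induction on the exponent. Points divisible by `p` are passed to the lower exponent; at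
primitive points the number of solutions of `x² ≡ x₀²` is weighed against the orbit size, except in
the case left to `norm_sq_sum_le_of_even`. -/
theorem norm_sq_sum_le [hp : Fact p.Prime] (hp3 : 3 < p) (hD : ¬ (p : ℤ) ∣ D)
    (hr : ¬ (p : ℤ) ∣ r) (h : IsThetaCoeff p k D r c) (y : ℤ) :
    ‖∑ x ∈ Finset.range (p ^ k), unitExp ((p ^ k) ^ 2) (r * x * y) * c x y‖ ^ 2 ≤
      ∑ y₁ ∈ Finset.range (p ^ k), ∑ y₂ ∈ Finset.range (p ^ k), ‖c y₁ y₂‖ ^ 2 := by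
  have hpp : Prime (p : ℤ) := Nat.prime_iff_prime_int.1 hp.out
  induction k generalizing c y with
  | zero =>
    have : ‖c 0 y‖ = ‖c 0 0‖ := h.norm_congr (by simp) (by simp)
    simp [norm_unitExp, this]
  | succ k ih =>
    by_cases hx : ∃ x₀ : ℤ, c x₀ y ≠ 0
    swap
    · push Not at hx
      simp only [hx, mul_zero, Finset.sum_const_zero, norm_zero]
      rw [zero_pow two_ne_zero]
      exact Finset.sum_nonneg fun _ _ => Finset.sum_nonneg fun _ _ => by positivity
    obtain ⟨x₀, hx₀⟩ := hx
    have hsupp : ∀ x : ℤ, c x y ≠ 0 → (p : ℤ) ^ (k + 1) ∣ x ^ 2 - x₀ ^ 2 := by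
      intro x hx
      have := h.dvd_sub_of_ne_zero (by lia) hr (Nat.succ_ne_zero k) hx hx₀
      rwa [sub_sub_sub_cancel_right] at this
    have hpk : (p : ℤ) ∣ (p : ℤ) ^ (k + 1) := dvd_pow_self _ (Nat.succ_ne_zero k)
    -- Divisibility by `p` is the same at all points of the support on this line, so primitivity can
    -- be tested at `x₀`.
    have hdvd : ∀ x : ℤ, c x y ≠ 0 → ((p : ℤ) ∣ x ↔ (p : ℤ) ∣ x₀) := by
      intro x hx
      have h1 := hpk.trans (hsupp x hx)
      rw [← hpp.dvd_pow_iff_dvd two_ne_zero, ← hpp.dvd_pow_iff_dvd (a := x₀) two_ne_zero]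
      exact (dvd_iff_dvd_of_dvd_sub h1)
    by_cases hdesc : (p : ℤ) ∣ x₀ ∧ (p : ℤ) ∣ y
    · obtain ⟨hpx, y, rfl⟩ := hdesc
      exact norm_sq_sum_le_of_descend (fun c hc y => ih hc y) h y fun x hx => by
        by_contra hne
        exact hx ((hdvd x hne).2 hpx)
    -- The modulus has exponent `k + 1`, so `¬ Even k` means an even exponent: this is the one case
    -- that `card_sqrt_sq_le` excludes.
    by_cases heven : (p : ℤ) ^ (k + 1) ∣ x₀ ^ 2 ∧ ¬ Even k
    · obtain ⟨hd, hodd⟩ := heven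
      obtain ⟨m, rfl⟩ := Nat.not_even_iff_odd.1 hodd
      have hpx : (p : ℤ) ∣ x₀ := hpp.dvd_of_dvd_pow (hpk.trans hd)
      have hy : ¬ (p : ℤ) ∣ y := fun hy => hdesc ⟨hpx, hy⟩
      rw [two_mul] at *
      refine norm_sq_sum_le_of_even hp3 hD hr h hy fun x hx => ?_
      by_contra hne
      have := dvd_add (hsupp x hne) hd
      rw [sub_add_cancel] at this
      exact hx (pow_dvd_of_pow_dvd_sq hpp (by lia) this)
    · set T := (Finset.range (p ^ (k + 1))).filter fun x : ℕ =>
        (p : ℤ) ^ (k + 1) ∣ (x : ℤ) ^ 2 - x₀ ^ 2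
      have hcard : T.card ^ 2 ≤ (p - 1) * p ^ k :=
        card_sqrt_sq_le hp3 x₀ fun h1 => by
          by_contra h2
          exact heven ⟨h1, h2⟩
      set E := ∑ y₁ ∈ Finset.range (p ^ (k + 1)), ∑ y₂ ∈ Finset.range (p ^ (k + 1)), ‖c y₁ y₂‖ ^ 2
      have hE : 0 ≤ E := Finset.sum_nonneg fun _ _ => Finset.sum_nonneg fun _ _ => by positivity
      have hcoeff : ∀ x : ℤ, ((p - 1) * p ^ k : ℝ) * ‖c x y‖ ^ 2 ≤ E := by
        intro x
        by_cases hx : c x y = 0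
        · simpa [hx] using hE
        · exact h.mul_norm_sq_le (by lia) hD fun hxy => hdesc ⟨(hdvd x hx).1 hxy.1, hxy.2⟩
      have hcard' : (T.card : ℝ) ^ 2 ≤ (p - 1) * p ^ k := by
        have : ((T.card ^ 2 : ℕ) : ℝ) ≤ (((p - 1) * p ^ k : ℕ) : ℝ) := by exact_mod_cast hcard
        rwa [Nat.cast_mul, Nat.cast_sub hp.out.one_le, Nat.cast_pow, Nat.cast_pow,
          Nat.cast_one] at this
      have hn : (0 : ℝ) < (p - 1) * p ^ k := by
        have : (1 : ℝ) < p := by exact_mod_cast hp.out.one_lt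
        have := sub_pos.2 this
        positivity
      have hle : ‖∑ x ∈ Finset.range (p ^ (k + 1)), unitExp ((p ^ (k + 1)) ^ 2) (r * x * y) *
          c x y‖ ≤ ∑ x ∈ T, ‖c x y‖ := by
        rw [← Finset.sum_subset (Finset.filter_subset _ _ : T ⊆ _)]
        · refine (norm_sum_le _ _).trans (le_of_eq ?_)
          simp_rw [norm_mul, norm_unitExp, one_mul]
          rfl
        · intro x hx hxT
          by_contra hne
          exact hxT (Finset.mem_filter.2 ⟨hx, hsupp x (right_ne_zero_of_mul hne)⟩)
      calc _ ≤ (∑ x ∈ T, ‖c x y‖) ^ 2 := pow_le_pow_left₀ (norm_nonneg _) hle 2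
        _ ≤ T.card * ∑ x ∈ T, ‖c x y‖ ^ 2 := sq_sum_le_card_mul_sum_sq
        _ ≤ T.card * ∑ x ∈ T, E / ((p - 1) * p ^ k) := by
          gcongr with x
          rw [le_div_iff₀ hn, mul_comm]
          exact hcoeff x
        _ = T.card ^ 2 * E / ((p - 1) * p ^ k) := by
          rw [Finset.sum_const, nsmul_eq_mul]; ring
        _ ≤ E := by
          rw [div_le_iff₀ hn, mul_comm]
          exact mul_le_mul_of_nonneg_left hcard' hE

end IsThetaCoeff

/-! ### Coefficients with respect to the `ζ_x`: equivariance, inversion, Parseval -/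

section Coefficients

variable {q : ℕ} [NeZero q] {r : (ZMod (q ^ 2))ˣ} {ψ : ZMod (q ^ 2) → ℂ}

variable (q r ψ) in
/-- The coefficient `⟨ψ, ζ_x⟩`, with the phase that makes it equivariant under the torus. -/
noncomputable def zetaCoeff (x₁ x₂ : ZMod (q ^ 2)) : ℂ :=
  ZMod.stdAddChar (-((r : ZMod (q ^ 2)) * x₁ * x₂)) * (star (zeta q r x₁ x₂) ⬝ᵥ ψ)

theorem stdAddChar_mul_neg {N : ℕ} [NeZero N] (a : ZMod N) :
    (ZMod.stdAddChar a : ℂ) * ZMod.stdAddChar (-a) = 1 := by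
  rw [← AddChar.map_add_eq_mul, add_neg_cancel, AddChar.map_zero_eq_one]

theorem norm_stdAddChar {N : ℕ} [NeZero N] (a : ZMod N) : ‖(ZMod.stdAddChar a : ℂ)‖ = 1 := by
  rw [← ZMod.intCast_zmod_cast a, stdAddChar_intCast, norm_unitExp]

theorem star_stdAddChar {N : ℕ} [NeZero N] (a : ZMod N) :
    star (ZMod.stdAddChar a : ℂ) = ZMod.stdAddChar (-a) := (AddChar.map_neg_eq_conj _ _).symm

theorem zeta_translate (x₁ x₂ a b : ZMod (q ^ 2)) :
    zeta q r (x₁ + (q : ZMod (q ^ 2)) * a) (x₂ + (q : ZMod (q ^ 2)) * b) =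
      (ZMod.stdAddChar (-(2 * (r : ZMod (q ^ 2)) * x₁ * ((q : ZMod (q ^ 2)) * b))) : ℂ) • zeta q r x₁ x₂ := by
  have hq := q_mul_q (q := q)
  ext y
  have e : (q : ZMod (q ^ 2)) * (y - (x₂ + (q : ZMod (q ^ 2)) * b)) = (q : ZMod (q ^ 2)) * (y - x₂) := by linear_combination -b * hq
  simp only [zeta, Pi.smul_apply, smul_eq_mul, e]
  split_ifs with h
  · rw [← AddChar.map_add_eq_mul]
    congr 1
    linear_combination 2 * (r : ZMod (q ^ 2)) * a * h - 2 * (r : ZMod (q ^ 2)) * a * b * hq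
  · simp

/-- The factor `e(-r x₁ x₂)` in `zetaCoeff`, combined with the phase of `zeta_translate`, makes the
translation phase the alternating form of the shift and the point. -/
theorem zetaCoeff_translate (x₁ x₂ a b : ZMod (q ^ 2)) :
    zetaCoeff q r ψ (x₁ + (q : ZMod (q ^ 2)) * a) (x₂ + (q : ZMod (q ^ 2)) * b) =
      ZMod.stdAddChar ((r : ZMod (q ^ 2)) * (q : ZMod (q ^ 2)) * (b * x₁ - a * x₂)) * zetaCoeff q r ψ x₁ x₂ := by
  have hq := q_mul_q (q := q)
  rw [zetaCoeff, zetaCoeff, zeta_translate, star_smul, smul_dotProduct, star_stdAddChar, smul_eq_mul]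
  have e : (ZMod.stdAddChar (-((r : ZMod (q ^ 2)) * (x₁ + (q : ZMod (q ^ 2)) * a) *
      (x₂ + (q : ZMod (q ^ 2)) * b))) : ℂ) * ZMod.stdAddChar (- -(2 * (r : ZMod (q ^ 2)) * x₁ *
        ((q : ZMod (q ^ 2)) * b))) = ZMod.stdAddChar ((r : ZMod (q ^ 2)) * (q : ZMod (q ^ 2)) *
        (b * x₁ - a * x₂)) * ZMod.stdAddChar (-((r : ZMod (q ^ 2)) * x₁ * x₂)) := by
    rw [← AddChar.map_add_eq_mul, ← AddChar.map_add_eq_mul]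
    congr 1
    linear_combination -(r : ZMod (q ^ 2)) * a * b * hq
  linear_combination (star (zeta q r x₁ x₂) ⬝ᵥ ψ) * e

theorem mulVec_dotProduct_mulVec {n : Type*} [Fintype n] [DecidableEq n] {W : Matrix n n ℂ}
    (hW : star W * W = 1) (v w : n → ℂ) : star (W *ᵥ v) ⬝ᵥ (W *ᵥ w) = star v ⬝ᵥ w := by
  rw [star_mulVec, dotProduct_mulVec, vecMul_vecMul, ← star_eq_conjTranspose, hW, vecMul_one]

open ComplexOrder in
theorem norm_eq_one_of_mulVec_eq {n : Type*} [Fintype n] [DecidableEq n] {W : Matrix n n ℂ}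
    (hW : star W * W = 1) {v : n → ℂ} (hv : v ≠ 0) {c : ℂ} (h : W *ᵥ v = c • v) : ‖c‖ = 1 := by
  have h1 := mulVec_dotProduct_mulVec hW v v
  rw [h, star_smul, smul_dotProduct, dotProduct_smul, smul_eq_mul, smul_eq_mul, ← mul_assoc] at h1
  have h2 : star v ⬝ᵥ v ≠ 0 := fun h0 => hv (dotProduct_star_self_eq_zero.1 h0)
  have h3 : star c * c = 1 := mul_right_cancel₀ h2 (h1.trans (one_mul _).symm)
  have h4 := congrArg norm h3
  rw [norm_mul, norm_star, norm_one] at h4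
  nlinarith [norm_nonneg c]

/-- The coefficients of an eigenvector of an operator that permutes the `ζ_x`. -/
theorem zetaCoeff_acts {W : Matrix (ZMod (q ^ 2)) (ZMod (q ^ 2)) ℂ} (hW : star W * W = 1)
    {g : SpecialLinearGroup (Fin 2) (ZMod (q ^ 2))} (hg : Acts q r W g) {c : ℂ} (hc : c ≠ 0)
    (h : W *ᵥ ψ = c • ψ) (x₁ x₂ : ZMod (q ^ 2)) :
    zetaCoeff q r ψ (g 0 0 * x₁ + g 0 1 * x₂) (g 1 0 * x₁ + g 1 1 * x₂) =
      c⁻¹ * zetaCoeff q r ψ x₁ x₂ := by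
  have h1 := mulVec_dotProduct_mulVec hW (zeta q r x₁ x₂) ψ
  rw [hg, h, star_smul, smul_dotProduct, dotProduct_smul, star_stdAddChar] at h1
  rw [zetaCoeff, zetaCoeff, ← h1]
  simp only [smul_eq_mul]
  rw [eq_inv_mul_iff_mul_eq₀ hc, ← mul_assoc, ← mul_assoc, ← AddChar.map_add_eq_mul, ← mul_assoc,
    mul_comm c]
  congr 3
  ring

theorem sum_zeta (h2 : IsUnit (2 : ZMod (q ^ 2))) (y₀ : ZMod (q ^ 2)) :
    ∑ j ∈ Finset.range q, zeta q r (j : ZMod (q ^ 2)) y₀ = (q : ℂ) • Pi.single y₀ (1 : ℂ) := by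
  have hu : IsUnit (2 * (r : ZMod (q ^ 2))) := h2.mul r.isUnit
  ext y
  simp only [Finset.sum_apply, zeta, Pi.smul_apply, smul_eq_mul]
  by_cases hy : (q : ZMod (q ^ 2)) * (y - y₀) = 0
  · obtain ⟨a, -, ha⟩ := exists_mul_of_mul_eq_zero hy
    have hs := sum_range_char (q := q) (2 * (r : ZMod (q ^ 2)) * (a : ZMod (q ^ 2)))
    simp only [hy, if_true]
    have e1 : ∀ j : ℕ, (2 * (r : ZMod (q ^ 2)) * (j : ZMod (q ^ 2)) * (y - y₀)) =
        2 * (r : ZMod (q ^ 2)) * (a : ZMod (q ^ 2)) * ((q : ZMod (q ^ 2)) * (j : ZMod (q ^ 2))) := by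
      intro j; rw [← ha]; ring
    simp_rw [e1]
    rw [hs, show (q : ZMod (q ^ 2)) * (2 * (r : ZMod (q ^ 2)) * (a : ZMod (q ^ 2))) =
      2 * (r : ZMod (q ^ 2)) * ((q : ZMod (q ^ 2)) * (a : ZMod (q ^ 2))) by ring, ha]
    simp only [hu.mul_right_eq_zero, sub_eq_zero, Pi.single_apply]
    split_ifs <;> simp
  · have hne : y ≠ y₀ := by rintro rfl; simp at hy
    simp [hy, hne]

/-- Inversion: the `ζ_{j, y}` with `j < q` sum to `q δ_y`, and the phase in `zetaCoeff` has to be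
undone. -/
theorem mul_apply_eq_sum_zetaCoeff (h2 : IsUnit (2 : ZMod (q ^ 2))) (y : ZMod (q ^ 2)) :
    (q : ℂ) * ψ y = ∑ j ∈ Finset.range q,
      ZMod.stdAddChar ((r : ZMod (q ^ 2)) * (j : ZMod (q ^ 2)) * y) * zetaCoeff q r ψ j y := by
  simp_rw [zetaCoeff, ← mul_assoc, stdAddChar_mul_neg, one_mul]
  rw [← sum_dotProduct, ← star_sum, sum_zeta h2, star_smul, smul_dotProduct]
  simp

/-- For fixed `x₂` the sum over `x₁` is Parseval's identity on the coset of `x₂` modulo `q`, with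
constant `q`; the `x₂ < q` represent every coset exactly once. -/
theorem sum_norm_sq_zetaCoeff (h2 : IsUnit (2 : ZMod (q ^ 2))) :
    ∑ x₁ ∈ Finset.range q, ∑ x₂ ∈ Finset.range q, ‖zetaCoeff q r ψ x₁ x₂‖ ^ 2 =
      q * ∑ y, ‖ψ y‖ ^ 2 := by
  have hu : IsUnit (2 * (r : ZMod (q ^ 2))) := h2.mul r.isUnit
  have h1 : ∀ x₂ : ZMod (q ^ 2), ∑ x₁ ∈ Finset.range q, ‖zetaCoeff q r ψ x₁ x₂‖ ^ 2 =
      q * ∑ y, if (q : ZMod (q ^ 2)) * (y - x₂) = 0 then ‖ψ y‖ ^ 2 else 0 := by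
    intro x₂
    have e : ∀ x₁ : ℕ, ((‖zetaCoeff q r ψ x₁ x₂‖ ^ 2 : ℝ) : ℂ) = ∑ y, ∑ y',
        if (q : ZMod (q ^ 2)) * (y - x₂) = 0 then
          (if (q : ZMod (q ^ 2)) * (y' - x₂) = 0 then
            ψ y * star (ψ y') * ZMod.stdAddChar (2 * (r : ZMod (q ^ 2)) * (y' - y) * (x₁ : ZMod (q ^ 2))) else 0)
          else 0 := by
      intro x₁
      rw [zetaCoeff, norm_mul, norm_stdAddChar, one_mul, Complex.ofReal_pow, ← Complex.mul_conj',
        dotProduct, map_sum, Finset.sum_mul_sum]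
      refine Finset.sum_congr rfl fun y _ => Finset.sum_congr rfl fun y' _ => ?_
      simp only [Pi.star_apply, zeta]
      split_ifs
      · rw [star_stdAddChar, map_mul, ← star_stdAddChar, starRingEnd_apply, starRingEnd_apply,
          star_star, star_stdAddChar]
        have e3 : (ZMod.stdAddChar (2 * (r : ZMod (q ^ 2)) * (y' - y) * (x₁ : ZMod (q ^ 2))) : ℂ) =
            ZMod.stdAddChar (-(2 * (r : ZMod (q ^ 2)) * (x₁ : ZMod (q ^ 2)) * (y - x₂))) *
            ZMod.stdAddChar (2 * (r : ZMod (q ^ 2)) * (x₁ : ZMod (q ^ 2)) * (y' - x₂)) := by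
          rw [← AddChar.map_add_eq_mul]
          congr 1
          ring
        rw [e3]
        ring
      · simp
      · simp
      · simp
    have e2 : ((∑ x₁ ∈ Finset.range q, ‖zetaCoeff q r ψ x₁ x₂‖ ^ 2 : ℝ) : ℂ) =
        ((q * ∑ y, if (q : ZMod (q ^ 2)) * (y - x₂) = 0 then ‖ψ y‖ ^ 2 else 0 : ℝ) : ℂ) := by
      rw [Complex.ofReal_sum]
      simp_rw [e]
      rw [Finset.sum_comm, Complex.ofReal_mul, Complex.ofReal_sum, Finset.mul_sum]
      refine Finset.sum_congr rfl fun y _ => ?_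
      rw [Finset.sum_comm]
      split_ifs with hy
      · rw [Finset.sum_eq_single y]
        · simp [hy, Complex.mul_conj']
        · intro y' _ hne
          split_ifs with hy'
          · rw [← Finset.mul_sum]
            obtain ⟨a, -, ha⟩ := exists_mul_of_mul_eq_zero
              (show (q : ZMod (q ^ 2)) * (y' - y) = 0 by linear_combination hy' - hy)
            have hs := sum_range_char (q := q) (2 * (r : ZMod (q ^ 2)) * (a : ZMod (q ^ 2)))
            rw [if_neg] at hs
            · convert mul_zero _
              rw [← hs]
              refine Finset.sum_congr rfl fun j _ => ?_
              rw [← ha]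
              congr 1
              ring
            · rw [show (q : ZMod (q ^ 2)) * (2 * (r : ZMod (q ^ 2)) * (a : ZMod (q ^ 2))) =
                2 * (r : ZMod (q ^ 2)) * ((q : ZMod (q ^ 2)) * (a : ZMod (q ^ 2))) by ring, ha,
                hu.mul_right_eq_zero, sub_eq_zero]
              exact hne
          · simp
        · simp
      · simp
    exact_mod_cast e2
  rw [Finset.sum_comm]
  simp_rw [h1]
  rw [← Finset.mul_sum, Finset.sum_comm]
  congr 1
  refine Finset.sum_congr rfl fun y _ => ?_
  have hiff : ∀ x : ℕ, (q : ZMod (q ^ 2)) * (y - x) = 0 ↔ (q : ℤ) ∣ (x : ℤ) - y.val := by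
    intro x
    have : (q : ZMod (q ^ 2)) * (y - x) = (((q : ℤ) * ((y.val : ℤ) - x) : ℤ) : ZMod (q ^ 2)) := by
      push_cast; simp
    rw [this, ZMod.intCast_zmod_eq_zero_iff_dvd, Nat.cast_pow, pow_two,
      mul_dvd_mul_iff_left (by exact_mod_cast NeZero.ne q), dvd_sub_comm]
  simp_rw [hiff]
  rw [← Finset.sum_filter, Finset.sum_const]
  have := card_filter_dvd_sub q 1 (NeZero.ne q) y.val
  rw [mul_one] at this
  rw [this, one_smul]

theorem star_opN_mul (b : ZMod (q ^ 2)) : star (opN q r b) * opN q r b = 1 := by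
  rw [opN, star_eq_conjTranspose, diagonal_conjTranspose, diagonal_mul_diagonal, ← diagonal_one]
  congr 1
  ext x
  rw [Pi.star_apply, star_stdAddChar, mul_comm, stdAddChar_mul_neg]

theorem star_opA_mul (t : (ZMod (q ^ 2))ˣ) : star (opA q t) * opA q t = 1 := by
  ext x y
  rw [star_eq_conjTranspose, mul_apply, one_apply]
  simp only [opA, conjTranspose_apply, of_apply]
  rw [Finset.sum_eq_single ((t⁻¹ : (ZMod (q ^ 2))ˣ) * x)]
  · simp [eq_comm]
  · intro z _ hz
    rw [if_neg]
    · simp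
    · rintro rfl
      simp at hz
  · simp

theorem star_opW_mul (h2 : IsUnit (2 : ZMod (q ^ 2))) : star (opW q r) * opW q r = 1 := by
  have hq : (q : ℂ) ≠ 0 := Nat.cast_ne_zero.2 (NeZero.ne q)
  have hu : IsUnit (2 * (r : ZMod (q ^ 2))) := h2.mul r.isUnit
  ext x y
  rw [star_eq_conjTranspose, mul_apply, one_apply]
  simp only [opW, conjTranspose_apply, of_apply]
  have e : ∀ z : ZMod (q ^ 2), star (1 / (q : ℂ) * ZMod.stdAddChar (2 * (r : ZMod (q ^ 2)) * z * x)) *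
      (1 / (q : ℂ) * ZMod.stdAddChar (2 * (r : ZMod (q ^ 2)) * z * y)) =
      1 / (q : ℂ) ^ 2 * ZMod.stdAddChar (z * (2 * (r : ZMod (q ^ 2)) * (y - x) - 0)) := by
    intro z
    rw [star_mul', star_stdAddChar, show z * (2 * (r : ZMod (q ^ 2)) * (y - x) - 0) =
      -(2 * (r : ZMod (q ^ 2)) * z * x) + 2 * (r : ZMod (q ^ 2)) * z * y by ring,
      AddChar.map_add_eq_mul]
    simp
    ring
  simp_rw [e]
  rw [← Finset.mul_sum, AddChar.sum_mulShift _ (ZMod.isPrimitive_stdAddChar (q ^ 2)), sub_zero]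
  simp only [hu.mul_right_eq_zero, sub_eq_zero, ZMod.card, eq_comm (a := y)]
  split_ifs
  · push_cast
    field_simp
  · simp

theorem star_mul_mul {n : Type*} [Fintype n] [DecidableEq n] {V W : Matrix n n ℂ}
    (hV : star V * V = 1) (hW : star W * W = 1) : star (V * W) * (V * W) = 1 := by
  rw [star_mul, mul_assoc, ← mul_assoc (star V), hV, one_mul, hW]

theorem star_weil_mul (h2 : IsUnit (2 : ZMod (q ^ 2)))
    (hloc : ∀ x y : ZMod (q ^ 2), IsUnit (x + y) → IsUnit x ∨ IsUnit y)
    (g : SpecialLinearGroup (Fin 2) (ZMod (q ^ 2))) : star (weil q r g) * weil q r g = 1 := by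
  have hB : ∀ a d c, star (bigCell q r a d c) * bigCell q r a d c = 1 := fun a d c =>
    star_mul_mul (star_mul_mul (star_mul_mul (star_opN_mul _) (star_opW_mul h2)) (star_opN_mul _))
      (star_opA_mul _)
  unfold weil
  split_ifs with hc ha
  · exact hB _ _ _
  · exact star_mul_mul (star_opW_mul h2) (hB _ _ _)
  · exfalso
    have hdet := g.det_coe
    rw [det_fin_two, sub_eq_add_neg] at hdet
    rcases hloc _ _ (hdet ▸ isUnit_one) with h | h
    · exact ha (isUnit_of_mul_isUnit_left h)
    · exact hc (isUnit_of_mul_isUnit_right (IsUnit.neg_iff _ |>.1 h))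

end Coefficients

/-! ### The upper bound and the extremal function at a prime power -/

section LocalBound

variable {p k : ℕ} [hp : Fact p.Prime] {r : (ZMod ((p ^ k) ^ 2))ˣ} {D : ZMod ((p ^ k) ^ 2)}
  {ψ : ZMod ((p ^ k) ^ 2) → ℂ}

theorem not_dvd_intCast_of_not_dvd {N p : ℕ} {a : ℤ} (h : ¬ (p : ZMod N) ∣ (a : ZMod N)) :
    ¬ (p : ℤ) ∣ a := by
  rintro ⟨b, rfl⟩
  exact h ⟨b, by push_cast; rfl⟩

theorem isThetaCoeff_zetaCoeff (hp2 : p ≠ 2)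
    (H : ∀ h ∈ torus D, ∃ c : ℂ, weil (p ^ k) r h *ᵥ ψ = c • ψ) :
    IsThetaCoeff p k ((D.val : ℕ) : ℤ) (((r : ZMod ((p ^ k) ^ 2)).val : ℕ) : ℤ)
      (fun x₁ x₂ => zetaCoeff (p ^ k) r ψ x₁ x₂) where
  translate x₁ x₂ a b := by
    have := zetaCoeff_translate (r := r) (ψ := ψ) (x₁ : ZMod ((p ^ k) ^ 2)) x₂ a b
    rw [← stdAddChar_intCast]
    push_cast at this ⊢
    rw [this, ZMod.natCast_zmod_val]
  rotate u v huv := by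
    have hpp : Prime (p : ℤ) := Nat.prime_iff_prime_int.1 hp.out
    obtain ⟨z, w, hzw⟩ := (((Prime.coprime_iff_not_dvd hpp).2 huv).pow_left (m := k)).pow_left (m := 2)
    set n := u ^ 2 - ((D.val : ℕ) : ℤ) * v ^ 2 with hn
    have hwn : ((w : ℤ) : ZMod ((p ^ k) ^ 2)) * ((u : ZMod ((p ^ k) ^ 2)) ^ 2 - D * v ^ 2) = 1 := by
      have h1 : ((z * ((p : ℤ) ^ k) ^ 2 + w * n : ℤ) : ZMod ((p ^ k) ^ 2)) = 1 := by
        rw [hzw, Int.cast_one]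
      have h2 : (((p : ZMod ((p ^ k) ^ 2)) ^ k) ^ 2) = 0 := by
        rw [← Nat.cast_pow, ← Nat.cast_pow, ZMod.natCast_self]
      rw [hn] at h1
      push_cast at h1
      rw [h2, ZMod.natCast_zmod_val, mul_zero, zero_add] at h1
      exact h1
    let g : SpecialLinearGroup (Fin 2) (ZMod ((p ^ k) ^ 2)) :=
      ⟨!![(w : ZMod ((p ^ k) ^ 2)) * (u ^ 2 + D * v ^ 2), (w * (2 * u * v)) * D;
        w * (2 * u * v), w * (u ^ 2 + D * v ^ 2)], by
        rw [det_fin_two_of]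
        linear_combination ((w : ZMod ((p ^ k) ^ 2)) * ((u : ZMod ((p ^ k) ^ 2)) ^ 2 - D * v ^ 2) + 1) * hwn⟩
    obtain ⟨c, hc⟩ := H g ⟨_, _, rfl⟩
    have hU := star_weil_mul (r := r) (isUnit_two (p := p) (k := k) hp2) isUnit_or_isUnit g
    have hA := acts_weil (r := r) (isUnit_two (p := p) (k := k) hp2) isUnit_or_isUnit g
    have hdvd : ((p : ℤ) ^ k) ^ 2 ∣ w * n - 1 := ⟨-z, by linear_combination hzw⟩
    -- `ψ` may vanish, since slices of an eigenfunction on `ℤ/M²ℤ` can be zero; the scalar supplied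
    -- by `H` then need not be unimodular.
    by_cases hψ : ψ = 0
    · refine ⟨w, 1, hdvd, norm_one, fun x₁ x₂ => ?_⟩
      simp [hψ, zetaCoeff]
    · have hc1 := norm_eq_one_of_mulVec_eq hU hψ hc
      have hc0 : c ≠ 0 := by rintro rfl; simp at hc1
      refine ⟨w, c⁻¹, hdvd, by rw [norm_inv, hc1, inv_one], fun x₁ x₂ => ?_⟩
      have := zetaCoeff_acts hU hA hc0 hc x₁ x₂
      rw [← this]
      push_cast
      rw [ZMod.natCast_zmod_val]
      congr 1
      · simp only [g, of_apply, cons_val', cons_val_zero, cons_val_one,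
          cons_val_fin_one]
        ring
      · simp only [g, of_apply, cons_val', cons_val_zero, cons_val_one,
          cons_val_fin_one]
        ring

/-- By inversion and Parseval, `IsThetaCoeff.norm_sq_sum_le` reads `q² ‖ψ y‖² ≤ q ∑ ‖ψ‖²`. -/
theorem mul_norm_sq_le_of_torus (hp3 : 3 < p) (hD : ¬ (p : ZMod ((p ^ k) ^ 2)) ∣ D)
    (H : ∀ h ∈ torus D, ∃ c : ℂ, weil (p ^ k) r h *ᵥ ψ = c • ψ) (y : ZMod ((p ^ k) ^ 2)) :
    ((p ^ k : ℕ) : ℝ) * ‖ψ y‖ ^ 2 ≤ ∑ z, ‖ψ z‖ ^ 2 := by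
  have hp2 : p ≠ 2 := by lia
  have h2 := isUnit_two (p := p) (k := k) hp2
  have hq : (0 : ℝ) < ((p ^ k : ℕ) : ℝ) := by exact_mod_cast pow_pos hp.out.pos k
  have hk : k ≠ 0 := by
    rintro rfl
    have : Subsingleton (ZMod ((p ^ 0) ^ 2)) := by
      rw [pow_zero, one_pow]; exact (inferInstance : Subsingleton (Fin 1))
    exact hD ⟨0, Subsingleton.elim _ _⟩
  have hD' : ¬ (p : ℤ) ∣ ((D.val : ℕ) : ℤ) :=
    not_dvd_intCast_of_not_dvd (N := (p ^ k) ^ 2) (by simpa using hD)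
  have hr : ¬ (p : ℤ) ∣ (((r : ZMod ((p ^ k) ^ 2)).val : ℕ) : ℤ) :=
    not_dvd_intCast_of_not_dvd (N := (p ^ k) ^ 2) (by
      rw [Int.cast_natCast, ZMod.natCast_zmod_val]
      intro h
      exact hD ((isUnit_of_dvd_unit h r.isUnit).dvd))
  have h := (isThetaCoeff_zetaCoeff hp2 H).norm_sq_sum_le hp3 hD' hr ((y.val : ℕ) : ℤ)
  have e1 := mul_apply_eq_sum_zetaCoeff (r := r) (ψ := ψ) h2 y
  have e2 := sum_norm_sq_zetaCoeff (r := r) (ψ := ψ) h2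
  have e3 : ∑ x ∈ Finset.range (p ^ k), unitExp ((p ^ k) ^ 2)
      ((((r : ZMod ((p ^ k) ^ 2)).val : ℕ) : ℤ) * x * ((y.val : ℕ) : ℤ)) *
      zetaCoeff (p ^ k) r ψ (x : ℤ) ((y.val : ℕ) : ℤ) = ((p ^ k : ℕ) : ℂ) * ψ y := by
    rw [e1]
    refine Finset.sum_congr rfl fun x _ => ?_
    rw [← stdAddChar_intCast]
    push_cast
    rw [ZMod.natCast_zmod_val, ZMod.natCast_zmod_val]
  rw [e3] at h
  simp only [Int.cast_natCast] at h
  rw [e2, norm_mul, Complex.norm_natCast, mul_pow, pow_two, mul_assoc] at h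
  exact le_of_mul_le_mul_left h hq

/-- The upper bound at a prime power, for the operators of the centralizer of a matrix `B` that is
conjugate to an element of the torus. -/
theorem mul_norm_sq_le_of_centralizer (hp3 : 3 < p) (hD : ¬ (p : ZMod ((p ^ k) ^ 2)) ∣ D)
    {B h : SpecialLinearGroup (Fin 2) (ZMod ((p ^ k) ^ 2))} {b : ZMod ((p ^ k) ^ 2)}
    (hh : h ∈ torus D) (hB : B = nMat b * h * nMat (-b)) (hu : IsUnit (B 1 0))
    (H : ∀ (g : SpecialLinearGroup (Fin 2) (ZMod ((p ^ k) ^ 2))) (x y : ZMod ((p ^ k) ^ 2)),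
      (g : Matrix (Fin 2) (Fin 2) (ZMod ((p ^ k) ^ 2))) =
        x • (1 : Matrix (Fin 2) (Fin 2) (ZMod ((p ^ k) ^ 2))) +
        y • (B : Matrix (Fin 2) (Fin 2) (ZMod ((p ^ k) ^ 2))) →
      ∃ c : ℂ, weil (p ^ k) r g *ᵥ ψ = c • ψ) (y : ZMod ((p ^ k) ^ 2)) :
    ((p ^ k : ℕ) : ℝ) * ‖ψ y‖ ^ 2 ≤ ∑ z, ‖ψ z‖ ^ 2 := by
  have hp2 : p ≠ 2 := by lia
  obtain ⟨α, β, hαβ⟩ := hh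
  have hh00 : h 0 0 = α := by rw [hαβ]; simp
  have hh01 : h 0 1 = β * D := by rw [hαβ]; simp
  have hh10 : h 1 0 = β := by rw [hαβ]; simp
  have hh11 : h 1 1 = α := by rw [hαβ]; simp
  have hβ : B 1 0 = β := by
    rw [hB, mul_entry, mul_entry, mul_entry, hh00, hh01, hh10, hh11]; simp [nMat]
  rw [hβ] at hu
  obtain ⟨γ, hγ⟩ := hu.exists_left_inv
  set φ := weil (p ^ k) r (nMat (-b)) *ᵥ ψ with hφ
  have hnorm : ∀ z, ‖φ z‖ = ‖ψ z‖ := by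
    intro z
    rw [hφ, weil_nMat hp2, opN, mulVec_diagonal, norm_mul, norm_stdAddChar, one_mul]
  have hφH : ∀ h ∈ torus D, ∃ c : ℂ, weil (p ^ k) r h *ᵥ φ = c • φ := by
    rintro h' ⟨a', b', hab⟩
    have h'00 : h' 0 0 = a' := by rw [hab]; simp
    have h'01 : h' 0 1 = b' * D := by rw [hab]; simp
    have h'10 : h' 1 0 = b' := by rw [hab]; simp
    have h'11 : h' 1 1 = a' := by rw [hab]; simp
    -- Since `γ β = 1`, one has `h' = (a' - b' γ α) + b' γ h`, and conjugating by `n_b` replaces `h`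
    -- by `B`: every torus element comes from the centralizer of `B`.
    obtain ⟨c, hc⟩ := H (nMat b * h' * nMat (-b)) (a' - b' * γ * α) (b' * γ) (by
      ext i j
      change (nMat b * h' * nMat (-b) : SpecialLinearGroup (Fin 2) (ZMod ((p ^ k) ^ 2))) i j =
        (a' - b' * γ * α) * (1 : Matrix (Fin 2) (Fin 2) (ZMod ((p ^ k) ^ 2))) i j + b' * γ * B i j
      fin_cases i <;> fin_cases j <;>
        simp only [hB, mul_entry, h'00, h'01, h'10, h'11, hh00, hh01, hh10, hh11, Fin.zero_eta, Fin.mk_one, Fin.isValue] <;>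
        simp [nMat]
      · linear_combination -b * b' * hγ
      · linear_combination -(b' * D - b ^ 2 * b') * hγ
      · linear_combination -b' * hγ
      · linear_combination b * b' * hγ)
    refine ⟨c, ?_⟩
    rw [hφ, mulVec_mulVec, ← weil_mul hp2, ← mulVec_smul, ← hc, mulVec_mulVec, ← weil_mul hp2]
    congr 2
    have : (nMat (-b) : SpecialLinearGroup (Fin 2) (ZMod ((p ^ k) ^ 2))) * nMat b = 1 := by
      ext i j
      fin_cases i <;> fin_cases j <;> simp only [mul_entry] <;> simp [nMat]
    rw [← mul_assoc, ← mul_assoc, this, one_mul]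
  have := mul_norm_sq_le_of_torus hp3 hD hφH y
  simpa only [hnorm] using this

theorem weil_one (hp2 : p ≠ 2) : weil (p ^ k) r 1 = 1 :=
  (acts_weil (isUnit_two hp2) isUnit_or_isUnit _).unique (isUnit_two hp2) fun x₁ x₂ => by
    simp

/-- Every `g` fixes the point `x = 0`, and the phase there is trivial. -/
theorem weil_mulVec_zeta_zero (hp2 : p ≠ 2)
    (g : SpecialLinearGroup (Fin 2) (ZMod ((p ^ k) ^ 2))) :
    weil (p ^ k) r g *ᵥ zeta (p ^ k) r 0 0 = zeta (p ^ k) r 0 0 := by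
  rw [acts_weil (isUnit_two hp2) isUnit_or_isUnit g]
  simp

end LocalBound

/-! ### Sup norms and the extremal function -/

section SupNorm

variable {M : ℕ} [NeZero M]

theorem rpow_one_div_four_sq (M : ℕ) : ((M ^ 2 : ℕ) : ℝ) ^ (1 / 4 : ℝ) = Real.sqrt M := by
  rw [Nat.cast_pow, ← Real.rpow_natCast, ← Real.rpow_mul (Nat.cast_nonneg _), Real.sqrt_eq_rpow]
  norm_num

theorem supNorm_le_of_mul_norm_sq_le {ψ : ZMod (M ^ 2) → ℂ} (hψ : IsNormalized ψ)
    (h : ∀ y, (M : ℝ) * ‖ψ y‖ ^ 2 ≤ ∑ z, ‖ψ z‖ ^ 2) :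
    supNorm ψ ≤ ((M ^ 2 : ℕ) : ℝ) ^ (1 / 4 : ℝ) := by
  have hM : (0 : ℝ) < M := by exact_mod_cast Nat.pos_of_ne_zero (NeZero.ne M)
  rw [rpow_one_div_four_sq]
  refine ciSup_le fun y => Real.le_sqrt_of_sq_le ?_
  have h1 := h y
  rw [IsNormalized, one_div, inv_mul_eq_one₀ (Nat.cast_ne_zero.2 (pow_ne_zero 2 (NeZero.ne M))), Nat.cast_pow] at hψ
  rw [← hψ, pow_two (M : ℝ)] at h1
  exact le_of_mul_le_mul_left h1 hM

variable (M) in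
/-- The normalized multiple of `ζ_0`. -/
noncomputable def zetaZero (y : ZMod (M ^ 2)) : ℂ :=
  if (M : ZMod (M ^ 2)) * y = 0 then (Real.sqrt M : ℂ) else 0

theorem isNormalized_zetaZero : IsNormalized (zetaZero M) := by
  have hM : (M : ℝ) ≠ 0 := by exact_mod_cast NeZero.ne M
  have h1 := sum_ideal_char (q := M) 0
  simp only [zero_mul, AddChar.map_zero_eq_one, mul_zero, if_true] at h1
  have h2 : ∑ u : ZMod (M ^ 2), (if (M : ZMod (M ^ 2)) * u = 0 then (1 : ℝ) else 0) = M := by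
    apply Complex.ofReal_injective
    rw [Complex.ofReal_sum, Complex.ofReal_natCast, ← h1]
    refine Finset.sum_congr rfl fun u _ => ?_
    split_ifs <;> simp
  have h3 : ∀ u : ZMod (M ^ 2), ‖zetaZero M u‖ ^ 2 =
      M * (if (M : ZMod (M ^ 2)) * u = 0 then (1 : ℝ) else 0) := by
    intro u
    rw [zetaZero]
    split_ifs
    · rw [Complex.norm_real, Real.norm_of_nonneg (Real.sqrt_nonneg _),
        Real.sq_sqrt (Nat.cast_nonneg _), mul_one]
    · simp
  rw [IsNormalized]
  simp_rw [h3]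
  rw [← Finset.mul_sum, h2]
  push_cast
  field_simp

theorem supNorm_zetaZero : supNorm (zetaZero M) = ((M ^ 2 : ℕ) : ℝ) ^ (1 / 4 : ℝ) := by
  rw [rpow_one_div_four_sq, supNorm]
  apply le_antisymm
  · refine ciSup_le fun y => ?_
    rw [zetaZero]
    split_ifs
    · rw [Complex.norm_real, Real.norm_of_nonneg (Real.sqrt_nonneg _)]
    · simp
  · refine le_trans (le_of_eq ?_) (le_ciSup (Set.finite_range _).bddAbove 0)
    rw [zetaZero, if_pos (mul_zero _), Complex.norm_real, Real.norm_of_nonneg (Real.sqrt_nonneg _)]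

theorem zetaZero_ne_zero : zetaZero M ≠ 0 := by
  intro h
  have := congrFun h 0
  rw [zetaZero, if_pos (mul_zero _)] at this
  have hM : (M : ℝ) ≠ 0 := by exact_mod_cast NeZero.ne M
  simp [hM] at this

theorem zetaZero_eq_smul (r : (ZMod (M ^ 2))ˣ) :
    zetaZero M = (Real.sqrt M : ℂ) • zeta M r 0 0 := by
  ext y
  simp [zetaZero, zeta]

end SupNorm

/-! ### From prime powers to composite `M` -/

theorem isUnit_intCast_of_not_dvd {p k : ℕ} [hp : Fact p.Prime] {a : ℤ} (h : ¬ (p : ℤ) ∣ a) :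
    IsUnit (a : ZMod ((p ^ k) ^ 2)) := by
  have hpp : Prime (p : ℤ) := Nat.prime_iff_prime_int.1 hp.out
  obtain ⟨z, w, hzw⟩ := (((Prime.coprime_iff_not_dvd hpp).2 h).pow_left (m := k)).pow_left (m := 2)
  have h1 : ((z * ((p : ℤ) ^ k) ^ 2 + w * a : ℤ) : ZMod ((p ^ k) ^ 2)) = 1 := by
    rw [hzw, Int.cast_one]
  have h2 : (((p : ZMod ((p ^ k) ^ 2)) ^ k) ^ 2) = 0 := by
    rw [← Nat.cast_pow, ← Nat.cast_pow, ZMod.natCast_self]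
  push_cast at h1
  rw [h2, mul_zero, zero_add] at h1
  exact IsUnit.of_mul_eq_one_right _ h1

/-- Iterate an estimate in one coordinate over all coordinates. -/
theorem prod_mul_le_sum_of_update {ι : Type*} [Fintype ι] [DecidableEq ι] {α : ι → Type*}
    [∀ i, Fintype (α i)] [∀ i, DecidableEq (α i)] (f : (∀ i, α i) → ℝ) (C : ι → ℝ)
    (hC : ∀ i, 0 ≤ C i) (h : ∀ i x, C i * f x ≤ ∑ z, f (Function.update x i z)) (x : ∀ i, α i) :
    (∏ i, C i) * f x ≤ ∑ z, f z := by
  -- `s` is the set of coordinates already summed over; the remaining ones are frozen at `x`.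
  have key : ∀ (s : Finset ι) (x : ∀ i, α i),
      (∏ i ∈ s, C i) * f x ≤ ∑ z, if ∀ i, i ∉ s → z i = x i then f z else 0 := by
    intro s
    induction s using Finset.induction_on with
    | empty =>
      intro x
      simp [← funext_iff]
    | insert j s hj ih =>
      intro x
      rw [Finset.prod_insert hj]
      calc C j * (∏ i ∈ s, C i) * f x = (∏ i ∈ s, C i) * (C j * f x) := by ring
        _ ≤ (∏ i ∈ s, C i) * ∑ w, f (Function.update x j w) :=
          mul_le_mul_of_nonneg_left (h j x) (Finset.prod_nonneg fun i _ => hC i)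
        _ = ∑ w, (∏ i ∈ s, C i) * f (Function.update x j w) := Finset.mul_sum _ _ _
        _ ≤ ∑ w, ∑ z, if ∀ i, i ∉ s → z i = Function.update x j w i then f z else 0 :=
          Finset.sum_le_sum fun w _ => ih _
        _ = ∑ z, ∑ w, if ∀ i, i ∉ s → z i = Function.update x j w i then f z else 0 :=
          Finset.sum_comm
        _ = _ := by
          refine Finset.sum_congr rfl fun z _ => ?_
          have e : ∀ w, (∀ i, i ∉ s → z i = Function.update x j w i) ↔
              w = z j ∧ ∀ i, i ∉ insert j s → z i = x i := by
            intro w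
            constructor
            · intro hz
              refine ⟨by simpa using (hz j hj).symm, fun i hi => ?_⟩
              rw [Finset.mem_insert, not_or] at hi
              simpa [hi.1] using hz i hi.2
            · rintro ⟨rfl, hz⟩ i hi
              by_cases hij : i = j
              · subst hij; simp
              · rw [Function.update_of_ne hij]
                exact hz i (by simp [hij, hi])
          simp_rw [e, ite_and]
          simp
  have := key Finset.univ x
  simpa using this

theorem red_natCast (M p n : ℕ) :
    red M p (n : ZMod (M ^ 2)) = (n : ZMod ((p ^ M.factorization p) ^ 2)) := map_natCast _ _

theorem map_nMat {R S : Type*} [CommRing R] [CommRing S] (f : R →+* S) (b : R) :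
    SpecialLinearGroup.map f (nMat b) = nMat (f b) := by
  ext i j
  rw [SpecialLinearGroup.map_apply_coe]
  fin_cases i <;> fin_cases j <;> simp [nMat]

section Tensor

variable (M : ℕ) [NeZero M]

/-- The local components of `ℤ/M²ℤ`. -/
abbrev LocalRing (p : M.primeFactors) : Type := ZMod (((p : ℕ) ^ M.factorization p) ^ 2)

theorem prod_ordProj : ∏ p : M.primeFactors, (p : ℕ) ^ M.factorization p = M := by
  rw [Finset.prod_coe_sort M.primeFactors fun p => p ^ M.factorization p]
  exact Nat.prod_factorization_pow_eq_self (NeZero.ne M)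

theorem dvd_iff_forall_ordProj_dvd (m n : ℕ) :
    M ^ m ∣ n ↔ ∀ p : M.primeFactors, ((p : ℕ) ^ M.factorization p) ^ m ∣ n := by
  constructor
  · intro h p
    exact (pow_dvd_pow_of_dvd (Nat.ordProj_dvd M p) m).trans h
  · intro h
    rw [← prod_ordProj M, ← Finset.prod_pow]
    refine Fintype.prod_dvd_of_isRelPrime (fun p q hpq => ?_) h
    rw [Function.onFun, ← Nat.coprime_iff_isRelPrime]
    exact Nat.Coprime.pow _ _ (Nat.Coprime.pow _ _ ((Nat.coprime_primes (Nat.prime_of_mem_primeFactors p.2)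
      (Nat.prime_of_mem_primeFactors q.2)).2 fun h => hpq (Subtype.ext h)))

theorem red_eq_val (p : ℕ) (x : ZMod (M ^ 2)) :
    red M p x = (x.val : ZMod ((p ^ M.factorization p) ^ 2)) := by
  rw [← red_natCast, ZMod.natCast_zmod_val]

theorem red_bijective : Function.Bijective (RingHom.pi fun p : M.primeFactors => red M p) := by
  rw [Fintype.bijective_iff_injective_and_card]
  constructor
  · rw [injective_iff_map_eq_zero]
    intro x hx
    have h1 : ∀ p : M.primeFactors, ((p : ℕ) ^ M.factorization p) ^ 2 ∣ x.val := by
      intro p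
      have h2 : red M p x = 0 := congrFun hx p
      rwa [red_eq_val, ZMod.natCast_eq_zero_iff] at h2
    rw [← dvd_iff_forall_ordProj_dvd, ← ZMod.natCast_eq_zero_iff, ZMod.natCast_zmod_val] at h1
    exact h1
  · rw [Fintype.card_pi]
    simp_rw [ZMod.card]
    rw [Finset.prod_pow, prod_ordProj]

/-- The Chinese remainder theorem. -/
noncomputable def crt : ZMod (M ^ 2) ≃+* ∀ p : M.primeFactors, LocalRing M p :=
  RingEquiv.ofBijective _ (red_bijective M)

variable {M} in
theorem crt_apply (x : ZMod (M ^ 2)) (p : M.primeFactors) : crt M x p = red M p x := rfl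

variable {M} in
theorem red_crt_symm (w : ∀ p : M.primeFactors, LocalRing M p) (p : M.primeFactors) :
    red M p ((crt M).symm w) = w p := by
  rw [← crt_apply, RingEquiv.apply_symm_apply]

/-- The local factors of the tensor product. -/
noncomputable def weilFactor (r : (ZMod (M ^ 2))ˣ)
    (g : SpecialLinearGroup (Fin 2) (ZMod (M ^ 2))) (p : M.primeFactors) :
    Matrix (LocalRing M p) (LocalRing M p) ℂ :=
  weil ((p : ℕ) ^ M.factorization p) (Units.map (red M p : ZMod (M ^ 2) →* _) r)
    (SpecialLinearGroup.map (red M p) g)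

variable {M} {r : (ZMod (M ^ 2))ˣ}

theorem weilTensor_mulVec_apply (g : SpecialLinearGroup (Fin 2) (ZMod (M ^ 2)))
    (ψ : ZMod (M ^ 2) → ℂ) (x : ZMod (M ^ 2)) :
    (weilTensor M r g *ᵥ ψ) x = ∑ w : ∀ p : M.primeFactors, LocalRing M p,
      (∏ p, weilFactor M r g p (red M p x) (w p)) * ψ ((crt M).symm w) := by
  rw [mulVec, dotProduct, ← Equiv.sum_comp (crt M).symm.toEquiv]
  refine Finset.sum_congr rfl fun w _ => ?_
  rw [weilTensor, of_apply]
  congr 1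
  rw [← Finset.prod_coe_sort]
  refine Finset.prod_congr rfl fun p _ => ?_
  rw [weilFactor, ← red_crt_symm w p]
  rfl

/-- Up to a constant, `zetaZero M` is the pure tensor of the local `ζ_0`, because divisibility by
`M` can be tested at each prime power; every tensor factor is fixed. -/
theorem weilTensor_mulVec_zetaZero (h2 : 2 ∉ M.primeFactors)
    (g : SpecialLinearGroup (Fin 2) (ZMod (M ^ 2))) :
    weilTensor M r g *ᵥ zetaZero M = zetaZero M := by
  have hfac : ∀ y : ZMod (M ^ 2), zetaZero M y = Real.sqrt M * ∏ p : M.primeFactors,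
      zeta ((p : ℕ) ^ M.factorization p) (Units.map (red M p : ZMod (M ^ 2) →* _) r) 0 0
        (red M p y) := by
    intro y
    have hdvd : ∀ (q n : ℕ) [NeZero q], (q : ZMod (q ^ 2)) * (n : ZMod (q ^ 2)) = 0 ↔ q ∣ n := by
      intro q n _
      rw [← Nat.cast_mul, ZMod.natCast_eq_zero_iff, pow_two,
        Nat.mul_dvd_mul_iff_left (Nat.pos_of_ne_zero (NeZero.ne q))]
    have h1 := dvd_iff_forall_ordProj_dvd M 1 y.val
    simp only [pow_one] at h1
    rw [zetaZero, ← ZMod.natCast_zmod_val y]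
    simp only [hdvd, h1, zeta, red_natCast, sub_zero, mul_zero, zero_mul, AddChar.map_zero_eq_one]
    rw [Finset.prod_ite_zero]
    simp only [Finset.mem_univ, forall_const, Finset.prod_const_one, mul_ite, mul_one, mul_zero]
  ext x
  rw [weilTensor_mulVec_apply, hfac x]
  simp_rw [hfac, red_crt_symm]
  have e : ∀ w : ∀ p : M.primeFactors, LocalRing M p,
      (∏ p, weilFactor M r g p (red M p x) (w p)) * ((Real.sqrt M : ℂ) * ∏ p : M.primeFactors,
      zeta ((p : ℕ) ^ M.factorization p) (Units.map (red M p : ZMod (M ^ 2) →* _) r) 0 0 (w p)) =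
      Real.sqrt M * ∏ p, (weilFactor M r g p (red M p x) (w p) *
      zeta ((p : ℕ) ^ M.factorization p) (Units.map (red M p : ZMod (M ^ 2) →* _) r) 0 0 (w p)) := by
    intro w
    rw [Finset.prod_mul_distrib]
    ring
  simp_rw [e]
  rw [← Finset.mul_sum, ← Fintype.prod_sum (fun (p : M.primeFactors) (z : LocalRing M p) =>
    weilFactor M r g p (red M p x) z *
      zeta ((p : ℕ) ^ M.factorization p) (Units.map (red M p : ZMod (M ^ 2) →* _) r) 0 0 z)]
  congr 1
  refine Finset.prod_congr rfl fun p _ => ?_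
  have : Fact (p : ℕ).Prime := ⟨Nat.prime_of_mem_primeFactors p.2⟩
  exact congrFun (weil_mulVec_zeta_zero (fun h => h2 (h ▸ p.2)) _) _

/-- The operators of elements that are trivial away from one prime act in one coordinate. -/
theorem weilTensor_mulVec_apply_of_eq_one (h2 : 2 ∉ M.primeFactors) (p : M.primeFactors)
    {g : SpecialLinearGroup (Fin 2) (ZMod (M ^ 2))}
    (hg : ∀ p' : M.primeFactors, p' ≠ p → SpecialLinearGroup.map (red M p') g = 1)
    (ψ : ZMod (M ^ 2) → ℂ) (w : ∀ p : M.primeFactors, LocalRing M p) :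
    (weilTensor M r g *ᵥ ψ) ((crt M).symm w) = ∑ z, weilFactor M r g p (w p) z *
      ψ ((crt M).symm (Function.update w p z)) := by
  rw [weilTensor_mulVec_apply]
  simp_rw [red_crt_symm]
  have hone : ∀ p' : M.primeFactors, p' ≠ p → weilFactor M r g p' = 1 := by
    intro p' hp'
    have : Fact (p' : ℕ).Prime := ⟨Nat.prime_of_mem_primeFactors p'.2⟩
    rw [weilFactor, hg p' hp']
    exact weil_one fun h => h2 (h ▸ p'.2)
  symm
  refine Fintype.sum_of_injective (fun z => Function.update w p z)
    (Function.update_injective w p) _ _ ?_ ?_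
  · intro v hv
    obtain ⟨p', hp', hne⟩ : ∃ p', p' ≠ p ∧ v p' ≠ w p' := by
      by_contra! hcon
      refine hv ⟨v p, ?_⟩
      ext p'
      by_cases h : p' = p
      · subst h; simp
      · simp [h, hcon p' h]
    rw [Finset.prod_eq_zero (Finset.mem_univ p'), zero_mul]
    rw [hone p' hp', one_apply_ne hne.symm]
  · intro z
    congr 1
    rw [Finset.prod_eq_single p]
    · simp
    · intro p' _ hp'
      rw [hone p' hp', Function.update_of_ne hp', one_apply_eq]
    · simp

/-- Freezing all CRT coordinates but one leaves a function to which `mul_norm_sq_le_of_centralizer`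
applies. The local constants `p^(k_p)` multiply to `M`. -/
theorem mul_norm_sq_le_of_isHeckeEigenfunction {A : SpecialLinearGroup (Fin 2) ℤ} {D : ZMod (M ^ 2)}
    (hA : HasParameter (M ^ 2) A D)
    (hM : ∀ p : ℕ, p.Prime → p ∣ M → 3 < p ∧ ¬ (p : ℤ) ∣ A 1 0 ∧ ¬ (p : ZMod (M ^ 2)) ∣ D)
    {ψ : ZMod (M ^ 2) → ℂ} (hψ : IsHeckeEigenfunction (weilTensor M r) A ψ) (y : ZMod (M ^ 2)) :
    (M : ℝ) * ‖ψ y‖ ^ 2 ≤ ∑ z, ‖ψ z‖ ^ 2 := by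
  have h2 : 2 ∉ M.primeFactors := by
    intro h
    have := (hM 2 Nat.prime_two (Nat.dvd_of_mem_primeFactors h)).1
    lia
  obtain ⟨b, h, ⟨α, β, hαβ⟩, hAh⟩ := hA
  have key := prod_mul_le_sum_of_update (α := LocalRing M) (fun w => ‖ψ ((crt M).symm w)‖ ^ 2)
    (fun p => (((p : ℕ) ^ M.factorization p : ℕ) : ℝ)) (fun _ => Nat.cast_nonneg _)
    (fun p w => ?_) (crt M y)
  · rw [← Nat.cast_prod, prod_ordProj, RingEquiv.symm_apply_apply] at key
    refine key.trans_eq ?_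
    exact Equiv.sum_comp (crt M).symm.toEquiv fun z => ‖ψ z‖ ^ 2
  · have hp : Fact (p : ℕ).Prime := ⟨Nat.prime_of_mem_primeFactors p.2⟩
    have hpM := Nat.dvd_of_mem_primeFactors p.2
    obtain ⟨hp3, hpA, hpD⟩ := hM p hp.out hpM
    have hloc := mul_norm_sq_le_of_centralizer (p := p) (k := M.factorization p)
      (r := Units.map (red M p : ZMod (M ^ 2) →* _) r) (D := red M p D)
      (ψ := fun z => ψ ((crt M).symm (Function.update w p z)))
      (B := SpecialLinearGroup.map (red M p) (modN (M ^ 2) A))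
      (h := SpecialLinearGroup.map (red M p) h) (b := red M p b) hp3 ?_ ?_ ?_ ?_ ?_ (w p)
    · simpa using hloc
    · intro hd
      apply hpD
      have h3 : (p : ℕ) ∣ ((p : ℕ) ^ M.factorization p) ^ 2 := by
        rw [← pow_mul]
        exact dvd_pow_self _ (mul_ne_zero
          (hp.out.factorization_pos_of_dvd (NeZero.ne M) hpM).ne' two_ne_zero)
      obtain ⟨c, hc⟩ := hd
      have h4 := congrArg (ZMod.castHom h3 (ZMod (p : ℕ))) hc
      rw [red_eq_val, map_mul, map_natCast, map_natCast, ZMod.natCast_self, zero_mul,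
        ZMod.natCast_eq_zero_iff] at h4
      obtain ⟨d, hd⟩ := h4
      refine ⟨d, ?_⟩
      rw [← Nat.cast_mul, ← hd, ZMod.natCast_zmod_val]
    · refine ⟨red M p α, red M p β, ?_⟩
      ext i j
      rw [SpecialLinearGroup.map_apply_coe, hαβ]
      fin_cases i <;> fin_cases j <;> simp
    · rw [hAh, map_mul, map_mul, map_nMat, map_nMat, map_neg]
    · have : (SpecialLinearGroup.map (red M p) (modN (M ^ 2) A)) 1 0 =
          ((A 1 0 : ℤ) : LocalRing M p) := by
        simp [modN]
      rw [this]
      exact isUnit_intCast_of_not_dvd hpA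
    · intro g a c hg
      -- The lift has coefficients `(a, c)` at `p` and `(1, 0)` at the other primes, so `G` reduces
      -- to `g` at `p` and to the identity elsewhere. Hence it has determinant `1` and belongs to
      -- the Hecke group of `A`.
      set a' := (crt M).symm (Function.update 1 p a) with ha'
      set c' := (crt M).symm (Function.update 0 p c) with hc'
      set G : Matrix (Fin 2) (Fin 2) (ZMod (M ^ 2)) := a' • 1 + c' • (modN (M ^ 2) A).1 with hG
      have hmap : ∀ p' : M.primeFactors, (red M p').mapMatrix G =
          Function.update (1 : ∀ p : M.primeFactors, LocalRing M p) p a p' • 1 +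
          Function.update (0 : ∀ p : M.primeFactors, LocalRing M p) p c p' •
            (SpecialLinearGroup.map (red M p') (modN (M ^ 2) A)).1 := by
        intro p'
        rw [hG, map_add, SpecialLinearGroup.map_apply_coe]
        congr 1
        · ext i j
          rw [RingHom.mapMatrix_apply, map_apply, Matrix.smul_apply, Matrix.smul_apply, smul_eq_mul, map_mul,
            ha', red_crt_symm, smul_eq_mul]
          congr 1
          simp only [one_apply]
          split_ifs <;> simp
        · ext i j
          rw [RingHom.mapMatrix_apply, map_apply, Matrix.smul_apply, Matrix.smul_apply, smul_eq_mul, map_mul,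
            hc', red_crt_symm, smul_eq_mul]
          rfl
      have hmap_self : (red M p).mapMatrix G = g.1 := by
        rw [hmap, Function.update_self, Function.update_self, hg]
      have hmap_ne : ∀ p' : M.primeFactors, p' ≠ p → (red M p').mapMatrix G = 1 := by
        intro p' hp'
        rw [hmap, Function.update_of_ne hp', Function.update_of_ne hp']
        simp
      have hdet : G.det = 1 := by
        apply (crt M).injective
        ext p'
        rw [crt_apply, crt_apply, map_one, RingHom.map_det]
        by_cases hp' : p' = p
        · subst hp'; rw [hmap_self]; exact g.2
        · rw [hmap_ne p' hp', det_one]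
      obtain ⟨e, he⟩ := hψ.2 ⟨G, hdet⟩ ⟨a', c', rfl⟩
      refine ⟨e, ?_⟩
      ext z
      have h5 := congrFun he ((crt M).symm (Function.update w p z))
      have hone : ∀ p' : M.primeFactors, p' ≠ p →
          SpecialLinearGroup.map (red M p') ⟨G, hdet⟩ = 1 := fun p' hp' =>
        Subtype.ext (hmap_ne p' hp')
      rw [weilTensor_mulVec_apply_of_eq_one h2 p hone] at h5
      simp only [Function.update_self, Function.update_idem] at h5
      have h6 : weilFactor M r ⟨G, hdet⟩ p = weil ((p : ℕ) ^ M.factorization p)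
          (Units.map (red M p : ZMod (M ^ 2) →* _) r) g :=
        congrArg (weil ((p : ℕ) ^ M.factorization p) _) (Subtype.ext hmap_self)
      rw [h6] at h5
      exact h5

end Tensor

end CatMap

theorem mainTheorem4 (A : Matrix.SpecialLinearGroup (Fin 2) ℤ) :
    (∀ (p k : ℕ) [Fact p.Prime], 3 < p → 1 ≤ k → ¬ (p : ℤ) ∣ A 1 0 →
      ∀ D : ZMod ((p ^ k) ^ 2), CatMap.HasParameter ((p ^ k) ^ 2) A D →
        ¬ (p : ZMod ((p ^ k) ^ 2)) ∣ D →
      ∀ r : (ZMod ((p ^ k) ^ 2))ˣ,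
        (∀ ψ : ZMod ((p ^ k) ^ 2) → ℂ,
          CatMap.IsHeckeEigenfunction (CatMap.weil (p ^ k) r) A ψ → CatMap.IsNormalized ψ →
          CatMap.supNorm ψ ≤ (((p ^ k) ^ 2 : ℕ) : ℝ) ^ (1 / 4 : ℝ)) ∧
        (∃ ψ : ZMod ((p ^ k) ^ 2) → ℂ,
          CatMap.IsHeckeEigenfunction (CatMap.weil (p ^ k) r) A ψ ∧ CatMap.IsNormalized ψ ∧
          CatMap.supNorm ψ = (((p ^ k) ^ 2 : ℕ) : ℝ) ^ (1 / 4 : ℝ))) ∧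
    (∀ (M : ℕ) [NeZero M] (D : ZMod (M ^ 2)), CatMap.HasParameter (M ^ 2) A D →
      (∀ p : ℕ, p.Prime → p ∣ M → 3 < p ∧ ¬ (p : ℤ) ∣ A 1 0 ∧ ¬ (p : ZMod (M ^ 2)) ∣ D) →
      ∀ r : (ZMod (M ^ 2))ˣ,
        (∀ ψ : ZMod (M ^ 2) → ℂ,
          CatMap.IsHeckeEigenfunction (CatMap.weilTensor M r) A ψ → CatMap.IsNormalized ψ →
          CatMap.supNorm ψ ≤ ((M ^ 2 : ℕ) : ℝ) ^ (1 / 4 : ℝ)) ∧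
        (∃ ψ : ZMod (M ^ 2) → ℂ,
          CatMap.IsHeckeEigenfunction (CatMap.weilTensor M r) A ψ ∧ CatMap.IsNormalized ψ ∧
          CatMap.supNorm ψ = ((M ^ 2 : ℕ) : ℝ) ^ (1 / 4 : ℝ))) := by
  refine ⟨fun p k _ hp3 _ hA D hD hpD r => ⟨fun ψ hψ hn => ?_, ?_⟩,
    fun M _ D hD hM r => ⟨fun ψ hψ hn => ?_, ?_⟩⟩
  · obtain ⟨b, h, hh, hB⟩ := hD
    refine CatMap.supNorm_le_of_mul_norm_sq_le hn
      (CatMap.mul_norm_sq_le_of_centralizer hp3 hpD hh hB ?_ fun g x y hg => hψ.2 g ⟨x, y, hg⟩)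
    have : CatMap.modN ((p ^ k) ^ 2) A 1 0 = ((A 1 0 : ℤ) : ZMod ((p ^ k) ^ 2)) := by
      simp [CatMap.modN]
    rw [this]
    exact CatMap.isUnit_intCast_of_not_dvd hA
  · refine ⟨CatMap.zetaZero (p ^ k), ⟨CatMap.zetaZero_ne_zero, fun g _ => ⟨1, ?_⟩⟩,
      CatMap.isNormalized_zetaZero, CatMap.supNorm_zetaZero⟩
    rw [CatMap.zetaZero_eq_smul r, Matrix.mulVec_smul, CatMap.weil_mulVec_zeta_zero (by lia),
      one_smul]
  · exact CatMap.supNorm_le_of_mul_norm_sq_le hn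
      (CatMap.mul_norm_sq_le_of_isHeckeEigenfunction hD hM hψ)
  · refine ⟨CatMap.zetaZero M, ⟨CatMap.zetaZero_ne_zero, fun g _ => ⟨1, ?_⟩⟩,
      CatMap.isNormalized_zetaZero, CatMap.supNorm_zetaZero⟩
    rw [one_smul, CatMap.weilTensor_mulVec_zetaZero]
    intro h
    have := (hM 2 Nat.prime_two (Nat.dvd_of_mem_primeFactors h)).1
    lia
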